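/- Let $p\ge 2$ be an integer. In the $p$-tensor Curie–Weiss model with parameter $\beta$, the sample $\boldsymbol X=(X_1,\dots,X_n)\in\{-1,1\}^n$ has law $$\mathbb P_{\beta,p}(\boldsymbol x)=\frac{1}{2^nZ_n(\beta,p)}\exp\Big\{\beta n^{1-p}\sum_{1\le i_1,\dots,i_p\le n}x_{i_1}\cdots x_{i_p}\Big\},$$ where $Z_n(\beta,p)$ is the normalizing constant. Put $\overline X=\frac1n\sum_{i=1}^n X_i$ and, for $x\in[-1,1]$, $$H_{\beta,p}(x)=\beta x^p-\tfrac12\{(1+x)\log(1+x)+(1-x)\log(1-x)\}\quad(0\log 0=0),\qquad \beta^*(p)=\sup\Big\{\beta\ge0:\sup_{x\in[-1,1]}H_{\beta,p}(x)=0\Big\}.$$ For $\beta>\beta^*(p)$ let $m_*(\beta,p)$ be the unique positive global maximizer of $H_{\beta,p}$ on $[-1,1]$. Let $\eta_p(t)=p^{-1}t^{1-p}\tanh^{-1}(t)$ for $t\in[-1,1]\setminus\{0\}$ and $\eta_p(0)=0$, with values in $[-\infty,\infty]$ ($\tanh^{-1}(\pm1)=\pm\infty$). Let $\hat\beta_{\mathrm{ML}}$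 be a maximum likelihood estimator, i.e. a maximizer of $b\mapsto\mathbb P_{b,p}(\boldsymbol X)$ over $b\in[-\infty,\infty]$ (values at $\pm\infty$ being limits). Let $\hat\beta_{\mathrm{MPL}}$ be the maximum pseudolikelihood estimator: either its explicit form $\eta_p(\overline X)$, or any maximizer over $b\in[-\infty,\infty]$ of the pseudolikelihood $\prod_{i=1}^n\mathbb P_{b,p}(X_i\mid (X_j)_{j\ne i})$; the statements below hold for both. Let $\beta>\beta_0>\beta^*(p)$. For an estimator $\hat\beta$ consider the test of $H_0:\beta=\beta_0$ against $H_1:\beta>\beta_0$ based on large values of $T_n=\sqrt n(\hat\beta-\beta_0)$, with $p$-value $L_n=1-F_{T_n,\beta_0}(T_n)$, where $F_{T_n,\beta_0}$ is the cumulative distribution function of $T_n$ under $\mathbb P_{\beta_0,p}$. The number $c$ is the weak Bahadur slope of the test at the alternative $\beta$ if $\frac1n\log L_n\to-\frac c2$ in probability under $\mathbb P_{\beta,p}$. The minimum sample size for significance at level $\delta$ is $N(\delta)=\inf\{N\ge1:\sup_{n\ge N}L_n\le\delta\}$. Then the weak Bahadur slopes of the tests based on $\hat\beta_{\mathrm{MPL}}$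 and $\hat\beta_{\mathrm{ML}}$ at $\beta$ exist and are, respectively, $$c_{\mathrm{MPL}}=2\Big(\sup_{x\in[-1,1]}H_{\beta_0,p}(x)-\sup_{x\in\eta_p^{-1}((\beta,\infty])}H_{\beta_0,p}(x)\Big),\qquad c_{\mathrm{ML}}=2\Big(\sup_{x\in[-1,1]}H_{\beta_0,p}(x)-\sup_{m_*(\beta,p)<x\le1}H_{\beta_0,p}(x)\Big).$$ Moreover, for every realization of the samples of all sizes $n\ge 1$ (the sample of size $n$ having law $\mathbb P_{\beta,p}$ on $\{-1,1\}^n$) on a common probability space, almost surely, as $\delta\to0^+$, $$N_{\mathrm{MPL}}(\delta)\sim\frac{\log\delta}{\sup_{x\in\eta_p^{-1}((\beta,\infty])}H_{\beta_0,p}(x)-\sup_{x\in[-1,1]}H_{\beta_0,p}(x)},\qquad N_{\mathrm{ML}}(\delta)\sim\frac{\log\delta}{\sup_{m_*(\beta,p)<x\le1}H_{\beta_0,p}(x)-\sup_{x\in[-1,1]}H_{\beta_0,p}(x)}.$$ -/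

import Mathlib

open Filter Topology MeasureTheory ProbabilityTheory Set
open scoped ENNReal

universe u

noncomputable section

namespace CurieWeiss

/-- A configuration of `n` spins, i.e. a point of the hypercube `{-1, 1} ^ n`
(`ℤˣ` is the two-element set `{1, -1}`). -/
abbrev Config (n : ℕ) : Type := Fin n → ℤˣ

/-- The spin of site `i` as a real number. -/
def spin {n : ℕ} (x : Config n) (i : Fin n) : ℝ := ((x i : ℤ) : ℝ)

/-- The average magnetization `n⁻¹ ∑ xᵢ`. -/
def avg {n : ℕ} (x : Config n) : ℝ := (∑ i, spin x i) / n

/-- The sufficient statistic `n ^ (1 - p) ∑ x_{i₁} ⋯ x_{iₚ}`, the sum being over all `p`-tuples of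
sites (repetitions allowed). -/
def hamiltonian (p : ℕ) {n : ℕ} (x : Config n) : ℝ :=
  (n : ℝ) ^ (1 - (p : ℤ)) * ∑ i : Fin p → Fin n, ∏ k, spin x (i k)

/-- The normalizing constant `Zₙ(β, p)`. -/
def partitionFn (p n : ℕ) (β : ℝ) : ℝ :=
  (∑ x : Config n, Real.exp (β * hamiltonian p x)) / 2 ^ n

/-- The probability mass function of the `p`-tensor Curie-Weiss model. -/
def pmf (p : ℕ) {n : ℕ} (β : ℝ) (x : Config n) : ℝ :=
  Real.exp (β * hamiltonian p x) / (2 ^ n * partitionFn p n β)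

/-- The law of the `p`-tensor Curie-Weiss model on `n` sites. -/
def law (p n : ℕ) (β : ℝ) : Measure (Config n) :=
  ∑ x : Config n, ENNReal.ofReal (pmf p β x) • Measure.dirac x

/-- `b` maximizes `f` over the extended real line: `f β` tends to the supremum of `f` as the real
variable `β` tends to `b`. For continuous `f` and finite `b` this says that `f b` is the
maximum of `f`. -/
def IsExtendedArgmax (f : ℝ → ℝ) (b : EReal) : Prop :=
  ∃ s : ℝ, IsLUB (range f) s ∧ Tendsto f (comap (fun β : ℝ => (β : EReal)) (𝓝 b)) (𝓝 s)

/-- `b` is a maximum likelihood estimate of `β` based on the observation `x`. -/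
def IsMLE (p : ℕ) {n : ℕ} (x : Config n) (b : EReal) : Prop :=
  IsExtendedArgmax (fun β => pmf p β x) b

/-- The conditional probability, under the model with parameter `β`, that the spin of site `i` is
`x i`, given that the other spins are as in `x`. -/
def condProb (p : ℕ) {n : ℕ} (β : ℝ) (x : Config n) (i : Fin n) : ℝ :=
  pmf p β x / ∑ s : ℤˣ, pmf p β (Function.update x i s)

/-- The pseudolikelihood function. -/
def pseudolikelihood (p : ℕ) {n : ℕ} (β : ℝ) (x : Config n) : ℝ :=
  ∏ i, condProb p β x i

/-- `b` is an exact maximizer of the pseudolikelihood based on the observation `x`. -/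
def IsMPLE (p : ℕ) {n : ℕ} (x : Config n) (b : EReal) : Prop :=
  IsExtendedArgmax (fun β => pseudolikelihood p β x) b

/-- The inverse hyperbolic tangent on `[-1, 1]`, infinite at the end points. -/
def artanhExt (t : ℝ) : EReal :=
  if t = 1 then ⊤ else if t = -1 then ⊥ else (Real.artanh t : EReal)

/-- The function `ηₚ : [-1, 1] → [-∞, ∞]`, `ηₚ(t) = p⁻¹ t ^ (1 - p) artanh t` for `t ≠ 0`,
`ηₚ(0) = 0`. -/
def eta (p : ℕ) (t : ℝ) : EReal :=
  if t = 0 then 0 else (((p : ℝ)⁻¹ * t ^ (1 - (p : ℤ)) : ℝ) : EReal) * artanhExt t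

/-- The explicit maximum pseudolikelihood estimator `ηₚ(X̄)` of the Curie-Weiss model. -/
def mple (p n : ℕ) (x : Config n) : EReal := eta p (avg x)

/-- The function `H_{β,p}` on `[-1, 1]` (with `0 log 0 = 0`). -/
def H (p : ℕ) (β x : ℝ) : ℝ :=
  β * x ^ p - ((1 + x) * Real.log (1 + x) + (1 - x) * Real.log (1 - x)) / 2

/-- `sup_{x ∈ [-1, 1]} H_{β,p}(x)`. -/
def supH (p : ℕ) (β : ℝ) : ℝ := sSup (H p β '' Icc (-1) 1)

/-- The threshold `β*(p)`. -/
def betaStar (p : ℕ) : ℝ := sSup {β : ℝ | 0 ≤ β ∧ supH p β = 0}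

/-- The positive global maximizer `m_*(β, p)` of `H_{β,p}` on `[-1, 1]` (it is unique for
`β > β*(p)`; without uniqueness the largest one is taken). -/
def mStar (p : ℕ) (β : ℝ) : ℝ :=
  sSup {x : ℝ | 0 < x ∧ x ≤ 1 ∧ IsMaxOn (H p β) (Icc (-1) 1) x}

/-- `sup_{x ∈ ηₚ⁻¹((β, ∞])} H_{β₀,p}(x)`. -/
def supHEta (p : ℕ) (β₀ β : ℝ) : ℝ :=
  sSup (H p β₀ '' {x : ℝ | x ∈ Icc (-1) 1 ∧ (β : EReal) < eta p x})

/-- `sup_{x > m_*(β, p)} H_{β₀,p}(x)`, where `x` ranges over the domain `[-1, 1]` of `H`. -/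
def supHRight (p : ℕ) (β₀ β : ℝ) : ℝ :=
  sSup (H p β₀ '' {x : ℝ | x ∈ Icc (-1) 1 ∧ mStar p β < x})

/-- An estimator of `β`, for every sample size. -/
abbrev Estimator : Type := (n : ℕ) → Config n → EReal

/-- The test statistic `Tₙ = √n (b - β₀)` based on the estimator `b`. -/
def testStat (β₀ : ℝ) (b : Estimator) (n : ℕ) (x : Config n) : EReal :=
  ((Real.sqrt n : ℝ) : EReal) * (b n x - (β₀ : EReal))

/-- The cumulative distribution function of `Tₙ` under the null `β₀`. -/
def nullCDF (p : ℕ) (β₀ : ℝ) (b : Estimator) (n : ℕ) (t : EReal) : ℝ :=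
  (law p n β₀).real {y | testStat β₀ b n y ≤ t}

/-- The p-value `Lₙ = 1 - F_{Tₙ,β₀}(Tₙ)`. -/
def pValue (p : ℕ) (β₀ : ℝ) (b : Estimator) (n : ℕ) (x : Config n) : ℝ :=
  1 - nullCDF p β₀ b n (testStat β₀ b n x)

/-- `c` is the weak Bahadur slope at the alternative `β` of the test based on `b`:
`n⁻¹ log Lₙ → - c / 2` in probability under the model with parameter `β`
(where `log 0 = -∞` is never close to `- c / 2`). -/
def HasWeakBahadurSlope (p : ℕ) (β₀ β : ℝ) (b : Estimator) (c : ℝ) : Prop :=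
  ∀ ε : ℝ, 0 < ε → Tendsto
    (fun n : ℕ => (law p n β).real {x | 0 < pValue p β₀ b n x ∧
      |Real.log (pValue p β₀ b n x) / n - (-c / 2)| < ε}) atTop (𝓝 1)

/-- `N(δ) = inf {N ≥ 1 : sup_{n ≥ N} Lₙ ≤ δ}` for a given sequence of samples. -/
def minSampleSize (p : ℕ) (β₀ : ℝ) (b : Estimator) (x : (n : ℕ) → Config n) (δ : ℝ) : ℕ :=
  sInf {N : ℕ | 1 ≤ N ∧ ∀ n, N ≤ n → pValue p β₀ b n (x n) ≤ δ}

/-- The minimum sample size of the test based on `b` satisfies `N(δ) ~ v(δ)` as `δ → 0+`, almost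
surely under the alternative `β`, however the samples of the different sizes `n` are realized on a
common probability space. -/
def HasMinSampleSize (p : ℕ) (β₀ β : ℝ) (b : Estimator) (v : ℝ → ℝ) : Prop :=
  ∀ (Ω : Type u) [MeasurableSpace Ω] (μ : Measure Ω) [IsProbabilityMeasure μ]
    (X : (n : ℕ) → Ω → Config n), (∀ n, HasLaw (X n) (law p n β) μ) →
    ∀ᵐ ω ∂μ, Tendsto
      (fun δ : ℝ => (minSampleSize p β₀ b (fun n => X n ω) δ : ℝ) / v δ) (𝓝[>] 0) (𝓝 1)

end CurieWeiss

end

open CurieWeiss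

/-!
Everything depends on a sample only through its magnetization `avg x`, because the sufficient
statistic is `n * avg x ^ p`. Counting configurations by their magnetization (`choose_mul_exp_le`,
`exp_le_choose_mul_exp`) shows that the magnetization satisfies, under the parameter `β`, a large
deviation principle with rate `supH p β - H p β` (`law_real_le`, `le_law_real`).

The p-value of the test based on `b` at the sample `x` is the probability under `β₀` that
`b x < b x'` for an independent sample `x'`. Under the alternative `β`, the magnetization of `x` is,
up to symmetry and outside an event of exponentially small probability, close to the unique positive
maximizer `mStar p β` of `H p β`. If, for such `x`, the event `b x < b x'` is up to small errors the
event that the magnetization of `x'` lies in an open set `A`, then the p-value decays like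
`exp (n (S - supH p β₀))` with `S` the supremum of `H p β₀` over `A`. The predicate `HasTailRate`
records this; it yields the weak slope directly and, by the Borel-Cantelli lemma, the minimum sample
size for every coupling of the samples.

The critical points of `H p β` are the solutions of `η = β`. The function `η` decreases and then
increases on `(0, 1)` (for `p = 2` it only increases), and `mStar p β` lies on the increasing branch
(`mStar_spec`); hence `mStar p β` increases with `β`, and `H p β₀` decreases to the right of
`mStar p β₀`.

* The maximum likelihood estimate is strictly increasing in the sufficient statistic (`IsMLE.lt`),
  so `A` is the set where `|x| > mStar p β` for even `p` and `x > mStar p β` for odd `p`.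
* The explicit maximum pseudolikelihood estimator is `η` of the magnetization, so `A` is the set
  where `η > β`. For `p ≥ 3` this set also contains points near `0`, where `H` is near `0`.
* For an exact maximizer of the pseudolikelihood, the score per site is a continuous function of
  `1 / n` and of the magnetization (`scoreDensity`), whose value at `1 / n = 0` has the sign of
  `η - t`; by compactness the estimator is compared with thresholds exactly as `η` is, away from the
  magnetization `0`. There the limiting score vanishes, and for `p = 2` its finite-size sign is
  controlled by an elementary bound (`scoreDensity_two_neg`). The structure `TracksEta` captures
  what both versions of the estimator share.
-/

noncomputable section

namespace CurieWeiss

/-! ### The model in terms of the magnetization -/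

lemma hamiltonian_eq {p n : ℕ} (hp : 1 ≤ p) (x : Config n) :
    hamiltonian p x = n * avg x ^ p := by
  unfold hamiltonian avg
  rw [← Fintype.sum_pow]
  rcases Nat.eq_zero_or_pos n with rfl | hn
  · have : p ≠ 0 := by omega
    simp [this]
  · have hn' : (n : ℝ) ≠ 0 := by positivity
    rw [zpow_sub₀ hn', zpow_natCast, zpow_one, div_pow]
    ring

lemma spin_eq_one_or {n : ℕ} (x : Config n) (i : Fin n) : spin x i = 1 ∨ spin x i = -1 := by
  rcases Int.units_eq_one_or (x i) with h | h <;> simp [spin, h]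

lemma avg_mem_Icc {n : ℕ} (x : Config n) : avg x ∈ Icc (-1 : ℝ) 1 := by
  have h : |∑ i, spin x i| ≤ n := by
    refine (Finset.abs_sum_le_sum_abs _ _).trans ?_
    have : ∀ i, |spin x i| = 1 := fun i => by
      rcases spin_eq_one_or x i with h | h <;> simp [h]
    simp [this]
  rw [mem_Icc, ← abs_le, avg, abs_div, Nat.abs_cast]
  exact div_le_one_of_le₀ h (by positivity)

lemma pmf_pos (p : ℕ) {n : ℕ} (β : ℝ) (x : Config n) : 0 < pmf p β x := by
  have : 0 < ∑ x : Config n, Real.exp (β * hamiltonian p x) :=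
    Finset.sum_pos (fun _ _ => Real.exp_pos _) ⟨fun _ => 1, Finset.mem_univ _⟩
  unfold pmf partitionFn
  positivity

lemma pmf_eq (p : ℕ) {n : ℕ} (β : ℝ) (x : Config n) :
    pmf p β x =
      Real.exp (β * hamiltonian p x) / ∑ y : Config n, Real.exp (β * hamiltonian p y) := by
  rw [pmf, partitionFn, mul_div_cancel₀ _ (by positivity)]

lemma sum_pmf (p n : ℕ) (β : ℝ) : ∑ x : Config n, pmf p β x = 1 := by
  simp_rw [pmf_eq, ← Finset.sum_div]
  exact div_self (Finset.sum_pos (fun _ _ => Real.exp_pos _) ⟨fun _ => 1, Finset.mem_univ _⟩).ne'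

lemma measurableSet_config {n : ℕ} (S : Set (Config n)) : MeasurableSet S := by
  have : MeasurableSingletonClass ℤˣ :=
    ⟨fun u => ⟨{(u : ℤ)}, MeasurableSet.singleton _, by ext v; simp [Units.ext_iff]⟩⟩
  exact S.toFinite.measurableSet

open Classical in
lemma law_apply (p n : ℕ) (β : ℝ) (S : Set (Config n)) :
    law p n β S = ENNReal.ofReal (∑ x : Config n, if x ∈ S then pmf p β x else 0) := by
  rw [law, Measure.finsetSum_apply,
    ENNReal.ofReal_sum_of_nonneg fun x _ => by split_ifs; exacts [(pmf_pos p β x).le, le_rfl]]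
  refine Finset.sum_congr rfl fun x _ => ?_
  rw [Measure.smul_apply, Measure.dirac_apply' _ (measurableSet_config S)]
  by_cases h : x ∈ S <;> simp [h]

instance (p n : ℕ) (β : ℝ) : IsProbabilityMeasure (law p n β) :=
  ⟨by rw [law_apply]; simp [sum_pmf]⟩

open Classical in
lemma law_real (p n : ℕ) (β : ℝ) (S : Set (Config n)) :
    (law p n β).real S = ∑ x : Config n, if x ∈ S then pmf p β x else 0 := by
  rw [measureReal_def, law_apply, ENNReal.toReal_ofReal]
  exact Finset.sum_nonneg fun x _ => by split_ifs; exacts [(pmf_pos p β x).le, le_rfl]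

/-! ### Counting configurations of given magnetization -/

/-- The magnetization of a configuration of `n` spins `k` of which are equal to `1`. -/
def level (n k : ℕ) : ℝ := (2 * k - n) / n

lemma sum_config (n : ℕ) (f : ℝ → ℝ) :
    ∑ x : Config n, f (avg x) = ∑ k ∈ Finset.range (n + 1), n.choose k * f (level n k) := by
  classical
  let e : Config n ≃ Finset (Fin n) :=
    { toFun := fun x => Finset.univ.filter fun i => x i = 1
      invFun := fun s i => if i ∈ s then 1 else -1
      left_inv := fun x => by
        funext i
        rcases Int.units_eq_one_or (x i) with h | h <;> simp [h]
      right_inv := fun s => by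
        ext i
        by_cases h : i ∈ s <;> simp [h] }
  have havg : ∀ x : Config n, avg x = level n (e x).card := by
    intro x
    have h : ∀ i, spin x i = 2 * (if x i = 1 then 1 else 0) - 1 := fun i => by
      rcases Int.units_eq_one_or (x i) with h | h <;> (simp [spin, h]; try norm_num)
    have hc : (((e x).card : ℕ) : ℝ) = ∑ i, if x i = 1 then (1 : ℝ) else 0 := by
      simp [e, Finset.sum_boole]
    rw [avg, level, hc, Finset.sum_congr rfl fun i _ => h i, Finset.sum_sub_distrib,
      ← Finset.mul_sum]
    simp
  simp_rw [havg]
  rw [e.sum_comp (fun s => f (level n s.card))]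
  have := Finset.sum_powerset_apply_card (fun k => f (level n k))
    (x := (Finset.univ : Finset (Fin n)))
  simpa [nsmul_eq_mul] using this

lemma factorial_mul_pow_le (j k : ℕ) : k.factorial * k ^ j ≤ j.factorial * k ^ k := by
  rcases le_total k j with h | h
  · obtain ⟨d, rfl⟩ := Nat.exists_eq_add_of_le h
    have := Nat.factorial_mul_pow_sub_le_factorial h
    rw [Nat.add_sub_cancel_left] at this
    calc k.factorial * k ^ (k + d) = (k.factorial * k ^ d) * k ^ k := by ring
      _ ≤ _ := by gcongr
  · obtain ⟨d, rfl⟩ := Nat.exists_eq_add_of_le h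
    have := Nat.factorial_mul_pow_sub_le_factorial h
    have h2 : (j + d).factorial ≤ j.factorial * (j + d) ^ d := by
      rw [← Nat.factorial_mul_ascFactorial]
      gcongr
      exact Nat.ascFactorial_le_pow_add _ _
    calc (j + d).factorial * (j + d) ^ j ≤ j.factorial * (j + d) ^ d * (j + d) ^ j := by gcongr
      _ = _ := by ring

/-- The number of successes `k` is a mode of the binomial law with parameters `n` and `k / n`. -/
lemma choose_mul_pow_le {n k : ℕ} (hk : k ≤ n) {j : ℕ} (hj : j ≤ n) :
    n.choose j * (k ^ j * (n - k) ^ (n - j)) ≤ n.choose k * (k ^ k * (n - k) ^ (n - k)) := by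
  have h1 := factorial_mul_pow_le j k
  have h2 := factorial_mul_pow_le (n - j) (n - k)
  have e1 := Nat.choose_mul_factorial_mul_factorial hj
  have e2 := Nat.choose_mul_factorial_mul_factorial hk
  have hpos : 0 < j.factorial * (n - j).factorial * (k.factorial * (n - k).factorial) := by
    positivity
  refine Nat.le_of_mul_le_mul_left ?_ hpos
  calc j.factorial * (n - j).factorial * (k.factorial * (n - k).factorial) *
        (n.choose j * (k ^ j * (n - k) ^ (n - j)))
      = (n.choose j * j.factorial * (n - j).factorial) *
        ((k.factorial * k ^ j) * ((n - k).factorial * (n - k) ^ (n - j))) := by ring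
    _ ≤ (n.choose j * j.factorial * (n - j).factorial) *
        ((j.factorial * k ^ k) * ((n - j).factorial * (n - k) ^ (n - k))) := by gcongr
    _ = (n.choose k * k.factorial * (n - k).factorial) *
        ((j.factorial * k ^ k) * ((n - j).factorial * (n - k) ^ (n - k))) := by rw [e1, e2]
    _ = _ := by ring

lemma choose_mul_pow_le_pow {n k : ℕ} (hk : k ≤ n) :
    n.choose k * (k ^ k * (n - k) ^ (n - k)) ≤ n ^ n := by
  have h := add_pow k (n - k) n
  rw [Nat.add_sub_cancel' hk] at h
  rw [h]
  calc _ = k ^ k * (n - k) ^ (n - k) * n.choose k := by ring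
    _ ≤ _ := Finset.single_le_sum (f := fun m => k ^ m * (n - k) ^ (n - m) * n.choose m)
      (fun _ _ => Nat.zero_le _) (Finset.mem_range.2 (by omega))

lemma pow_le_choose_mul_pow {n k : ℕ} (hk : k ≤ n) :
    n ^ n ≤ (n + 1) * (n.choose k * (k ^ k * (n - k) ^ (n - k))) := by
  have h := add_pow k (n - k) n
  rw [Nat.add_sub_cancel' hk] at h
  rw [h]
  refine (Finset.sum_le_card_nsmul _ _ (n.choose k * (k ^ k * (n - k) ^ (n - k)))
    fun j hj => ?_).trans ?_
  · rw [mul_comm]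
    exact choose_mul_pow_le hk (by simpa [Nat.lt_succ_iff] using hj)
  · simp

/-- `2ⁿ kᵏ (n - k)ⁿ⁻ᵏ / nⁿ` is the exponential of `n` times the entropy term of `H`. -/
lemma pow_mul_pow_eq_exp {n k : ℕ} (hn : 1 ≤ n) (hk : k ≤ n) (p : ℕ) (β : ℝ) :
    ((k ^ k * (n - k) ^ (n - k) : ℕ) : ℝ) * 2 ^ n * Real.exp (n * H p β (level n k)) =
      n ^ n * Real.exp (β * (n * level n k ^ p)) := by
  have hn' : (0 : ℝ) < n := by exact_mod_cast hn
  have hkn : ((n - k : ℕ) : ℝ) = n - k := by push_cast [hk]; ring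
  have key : ∀ a : ℕ, (a : ℝ) ^ a * 2 ^ a = n ^ a *
      Real.exp (a * Real.log (2 * a / n)) := by
    intro a
    rcases Nat.eq_zero_or_pos a with rfl | ha
    · simp
    · have ha' : (0 : ℝ) < a := by exact_mod_cast ha
      rw [← Real.log_pow, Real.exp_log (by positivity), div_pow, mul_pow]
      field_simp
  have h1 : 1 + level n k = 2 * k / n := by rw [level]; field_simp; ring
  have h2 : 1 - level n k = 2 * (n - k : ℕ) / n := by rw [level, hkn]; field_simp; ring
  have hH : n * H p β (level n k) = β * (n * level n k ^ p) -
      (k * Real.log (2 * k / n) + (n - k : ℕ) * Real.log (2 * (n - k : ℕ) / n)) := by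
    rw [H, h1, h2]
    field_simp
  have e1 := key k
  have e2 := key (n - k)
  have en : (n : ℝ) ^ n = n ^ k * n ^ (n - k) := by rw [← pow_add, Nat.add_sub_cancel' hk]
  have e2n : (2 : ℝ) ^ n = 2 ^ k * 2 ^ (n - k) := by rw [← pow_add, Nat.add_sub_cancel' hk]
  rw [hH, Real.exp_sub, Real.exp_add, en, e2n]
  push_cast
  calc _ = ((k : ℝ) ^ k * 2 ^ k) * (((n - k : ℕ) : ℝ) ^ (n - k) * 2 ^ (n - k)) *
        (Real.exp (β * (n * level n k ^ p)) / (Real.exp (k * Real.log (2 * k / n)) *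
          Real.exp ((n - k : ℕ) * Real.log (2 * (n - k : ℕ) / n)))) := by ring
    _ = _ := by
      rw [e1, e2]
      field_simp

lemma choose_mul_exp_le {n k : ℕ} (hn : 1 ≤ n) (hk : k ≤ n) (p : ℕ) (β : ℝ) :
    n.choose k * Real.exp (β * (n * level n k ^ p)) ≤ 2 ^ n * Real.exp (n * H p β (level n k)) := by
  have hn' : (0 : ℝ) < n := by exact_mod_cast hn
  have h := pow_mul_pow_eq_exp hn hk p β
  have h1 : ((n.choose k : ℕ) : ℝ) * ((k ^ k * (n - k) ^ (n - k) : ℕ) : ℝ) ≤ n ^ n := by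
    exact_mod_cast choose_mul_pow_le_pow hk
  refine le_of_mul_le_mul_left ?_ (pow_pos hn' n)
  calc (n : ℝ) ^ n * (n.choose k * Real.exp (β * (n * level n k ^ p)))
      = n.choose k * (n ^ n * Real.exp (β * (n * level n k ^ p))) := by ring
    _ = (n.choose k * ((k ^ k * (n - k) ^ (n - k) : ℕ) : ℝ)) *
        (2 ^ n * Real.exp (n * H p β (level n k))) := by rw [← h]; ring
    _ ≤ _ := by gcongr

lemma exp_le_choose_mul_exp {n k : ℕ} (hn : 1 ≤ n) (hk : k ≤ n) (p : ℕ) (β : ℝ) :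
    2 ^ n * Real.exp (n * H p β (level n k)) ≤
      (n + 1) * (n.choose k * Real.exp (β * (n * level n k ^ p))) := by
  have hn' : (0 : ℝ) < n := by exact_mod_cast hn
  have h := pow_mul_pow_eq_exp hn hk p β
  have h1 : (n : ℝ) ^ n ≤
      (n + 1) * (((n.choose k : ℕ) : ℝ) * ((k ^ k * (n - k) ^ (n - k) : ℕ) : ℝ)) := by
    exact_mod_cast pow_le_choose_mul_pow hk
  refine le_of_mul_le_mul_left ?_ (pow_pos hn' n)
  calc (n : ℝ) ^ n * (2 ^ n * Real.exp (n * H p β (level n k)))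
      ≤ ((n + 1) * (n.choose k * ((k ^ k * (n - k) ^ (n - k) : ℕ) : ℝ))) *
        (2 ^ n * Real.exp (n * H p β (level n k))) := by gcongr
    _ = (n + 1) * n.choose k * (((k ^ k * (n - k) ^ (n - k) : ℕ) : ℝ) * 2 ^ n *
        Real.exp (n * H p β (level n k))) := by ring
    _ = _ := by rw [h]; ring

/-! ### Large deviations of the magnetization -/

lemma continuous_H (p : ℕ) (β : ℝ) : Continuous (H p β) := by
  have h := Real.continuous_mul_log
  have h1 : Continuous fun x : ℝ => (1 + x) * Real.log (1 + x) :=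
    h.comp (continuous_const.add continuous_id)
  have h2 : Continuous fun x : ℝ => (1 - x) * Real.log (1 - x) :=
    h.comp (continuous_const.sub continuous_id)
  unfold H
  fun_prop

lemma H_le_supH (p : ℕ) (β : ℝ) {x : ℝ} (hx : x ∈ Icc (-1 : ℝ) 1) : H p β x ≤ supH p β :=
  le_csSup (isCompact_Icc.image (continuous_H p β)).bddAbove (mem_image_of_mem _ hx)

lemma exists_H_eq_supH (p : ℕ) (β : ℝ) : ∃ x ∈ Icc (-1 : ℝ) 1, H p β x = supH p β :=
  (isCompact_Icc.image (continuous_H p β)).sSup_mem ((nonempty_Icc.2 (by norm_num)).image _)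

lemma tendsto_level {y : ℝ} (hy : y ∈ Icc (-1 : ℝ) 1) :
    Tendsto (fun n : ℕ => level n ⌊(1 + y) / 2 * n⌋₊) atTop (𝓝 y) := by
  have h := (tendsto_nat_floor_mul_div_atTop (R := ℝ) (a := (1 + y) / 2)
    (by linarith [hy.1])).comp tendsto_natCast_atTop_atTop
  have h2 : Tendsto (fun n : ℕ => 2 * ((⌊(1 + y) / 2 * n⌋₊ : ℝ) / n) - 1) atTop
      (𝓝 (2 * ((1 + y) / 2) - 1)) := (h.const_mul 2).sub_const 1
  have e : 2 * ((1 + y) / 2) - 1 = y := by ring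
  rw [e] at h2
  refine h2.congr' ?_
  filter_upwards [eventually_ge_atTop 1] with n hn
  have : (n : ℝ) ≠ 0 := by positivity
  rw [level]
  field_simp

lemma floor_le_of_mem_Icc {y : ℝ} (hy : y ∈ Icc (-1 : ℝ) 1) (n : ℕ) : ⌊(1 + y) / 2 * n⌋₊ ≤ n := by
  refine Nat.floor_le_of_le ?_
  have : (0 : ℝ) ≤ n := by positivity
  nlinarith [hy.2]

lemma eventually_add_one_le_exp {ε : ℝ} (hε : 0 < ε) :
    ∀ᶠ n : ℕ in atTop, (n : ℝ) + 1 ≤ Real.exp (n * ε) := by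
  have h := (Real.tendsto_exp_div_pow_atTop 1).comp
    (tendsto_natCast_atTop_atTop.atTop_mul_const hε :
      Tendsto (fun n : ℕ => (n : ℝ) * ε) atTop atTop)
  filter_upwards [h.eventually_ge_atTop (2 / ε), eventually_ge_atTop 1] with n hn hn1
  have hn' : (1 : ℝ) ≤ n := by exact_mod_cast hn1
  simp only [Function.comp, pow_one] at hn
  rw [div_le_div_iff₀ hε (by positivity)] at hn
  nlinarith

open Classical in
lemma law_real_eq_div {p : ℕ} (hp : 1 ≤ p) (n : ℕ) (β : ℝ) (S : Set (Config n)) :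
    (law p n β).real S = (∑ x : Config n, if x ∈ S then Real.exp (β * (n * avg x ^ p)) else 0) /
      ∑ x : Config n, Real.exp (β * (n * avg x ^ p)) := by
  simp_rw [law_real, pmf_eq, hamiltonian_eq hp, Finset.sum_div]
  exact Finset.sum_congr rfl fun x _ => by split_ifs <;> simp

open Classical in
lemma sum_exp_le {p n : ℕ} (hn : 1 ≤ n) (β M : ℝ) :
    ∑ x : Config n, (if H p β (avg x) ≤ M then Real.exp (β * (n * avg x ^ p)) else 0) ≤
      (n + 1) * (2 ^ n * Real.exp (n * M)) := by
  rw [sum_config n fun z => if H p β z ≤ M then Real.exp (β * (n * z ^ p)) else 0]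
  refine (Finset.sum_le_card_nsmul _ _ (2 ^ n * Real.exp (n * M)) fun k hk => ?_).trans_eq ?_
  · split_ifs with h
    · refine (choose_mul_exp_le hn (by simpa [Nat.lt_succ_iff] using hk) p β).trans ?_
      gcongr
    · rw [mul_zero]; positivity
  · simp

open Classical in
lemma le_sum_exp {p : ℕ} {β y : ℝ} (hy : y ∈ Icc (-1 : ℝ) 1) {U : Set ℝ} (hU : U ∈ 𝓝 y)
    {ε : ℝ} (hε : 0 < ε) :
    ∀ᶠ n : ℕ in atTop, 2 ^ n * Real.exp (n * (H p β y - ε)) ≤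
      ∑ x : Config n, if avg x ∈ U then Real.exp (β * (n * avg x ^ p)) else 0 := by
  have hlev := tendsto_level hy
  have hH : ∀ᶠ z in 𝓝 y, H p β y - ε / 2 < H p β z :=
    (continuous_H p β).continuousAt.eventually (lt_mem_nhds (by linarith))
  filter_upwards [hlev.eventually hU, hlev.eventually hH, eventually_add_one_le_exp (half_pos hε),
    eventually_ge_atTop 1] with n hnU hnH hnε hn
  set k := ⌊(1 + y) / 2 * n⌋₊
  have hk : k ≤ n := floor_le_of_mem_Icc hy n
  rw [sum_config n fun z => if z ∈ U then Real.exp (β * (n * z ^ p)) else 0]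
  have h1 : (n.choose k : ℝ) * (if level n k ∈ U then Real.exp (β * (n * level n k ^ p)) else 0) ≤
      ∑ k ∈ Finset.range (n + 1), n.choose k *
        (if level n k ∈ U then Real.exp (β * (n * level n k ^ p)) else 0) :=
    Finset.single_le_sum (f := fun k => (n.choose k : ℝ) *
        (if level n k ∈ U then Real.exp (β * (n * level n k ^ p)) else 0))
      (fun j _ => by split_ifs <;> positivity) (Finset.mem_range.2 (by omega))
  refine le_trans ?_ h1
  rw [if_pos (show level n k ∈ U from hnU)]
  have h2 := exp_le_choose_mul_exp hn hk p β
  have hpos : (0 : ℝ) < n + 1 := by positivity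
  refine le_of_mul_le_mul_left ?_ hpos
  refine le_trans ?_ h2
  calc ((n : ℝ) + 1) * (2 ^ n * Real.exp (n * (H p β y - ε)))
      ≤ Real.exp (n * (ε / 2)) * (2 ^ n * Real.exp (n * (H p β y - ε))) := by gcongr
    _ = 2 ^ n * Real.exp (n * (H p β y - ε / 2)) := by
      rw [mul_left_comm, ← Real.exp_add]; ring_nf
    _ ≤ _ := by gcongr

/-- Large deviation upper bound, uniform over the level `M`. -/
lemma law_real_le {p : ℕ} (hp : 1 ≤ p) (β : ℝ) {ε : ℝ} (hε : 0 < ε) :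
    ∀ᶠ n : ℕ in atTop, ∀ (M : ℝ) (S : Set (Config n)), (∀ x ∈ S, H p β (avg x) ≤ M) →
      (law p n β).real S ≤ Real.exp (n * (M - supH p β + ε)) := by
  classical
  obtain ⟨y, hy, hyH⟩ := exists_H_eq_supH p β
  filter_upwards [le_sum_exp (p := p) (β := β) hy univ_mem (half_pos hε),
    eventually_add_one_le_exp (half_pos hε), eventually_ge_atTop 1] with n h1 h2 hn M S hS
  simp only [mem_univ, if_true, hyH] at h1
  rw [law_real_eq_div hp, div_le_iff₀ (lt_of_lt_of_le (by positivity) h1)]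
  calc (∑ x : Config n, if x ∈ S then Real.exp (β * (n * avg x ^ p)) else 0)
      ≤ ∑ x : Config n, (if H p β (avg x) ≤ M then Real.exp (β * (n * avg x ^ p)) else 0) := by
        refine Finset.sum_le_sum fun x _ => ?_
        by_cases hx : x ∈ S
        · simp [hx, hS x hx]
        · rw [if_neg hx]; split_ifs <;> positivity
    _ ≤ (n + 1) * (2 ^ n * Real.exp (n * M)) := sum_exp_le hn β M
    _ ≤ Real.exp (n * (ε / 2)) * (2 ^ n * Real.exp (n * M)) := by gcongr
    _ = Real.exp (n * (M - supH p β + ε)) * (2 ^ n * Real.exp (n * (supH p β - ε / 2))) := by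
      rw [mul_left_comm, mul_left_comm (Real.exp _), ← Real.exp_add, ← Real.exp_add]; ring_nf
    _ ≤ _ := by gcongr

/-- Large deviation lower bound for a neighbourhood of a point. -/
lemma le_law_real {p : ℕ} (hp : 1 ≤ p) {β y : ℝ} (hy : y ∈ Icc (-1 : ℝ) 1) {U : Set ℝ}
    (hU : U ∈ 𝓝 y) {ε : ℝ} (hε : 0 < ε) :
    ∀ᶠ n : ℕ in atTop,
      Real.exp (n * (H p β y - supH p β - ε)) ≤ (law p n β).real {x | avg x ∈ U} := by
  classical
  filter_upwards [le_sum_exp (p := p) (β := β) hy hU (half_pos hε),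
    eventually_add_one_le_exp (half_pos hε), eventually_ge_atTop 1] with n h1 h2 hn
  have h3 := sum_exp_le (p := p) hn β (supH p β)
  simp only [H_le_supH p β (avg_mem_Icc _), if_true] at h3
  rw [law_real_eq_div hp, le_div_iff₀
    (Finset.sum_pos (fun _ _ => Real.exp_pos _) ⟨fun _ => 1, Finset.mem_univ _⟩)]
  calc _ ≤ Real.exp (n * (H p β y - supH p β - ε)) *
        ((n + 1) * (2 ^ n * Real.exp (n * supH p β))) := by gcongr
    _ ≤ Real.exp (n * (H p β y - supH p β - ε)) *
        (Real.exp (n * (ε / 2)) * (2 ^ n * Real.exp (n * supH p β))) := by gcongr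
    _ = 2 ^ n * Real.exp (n * (H p β y - ε / 2)) := by
      rw [mul_left_comm (Real.exp (n * (ε / 2))), mul_left_comm, ← Real.exp_add, ← Real.exp_add]
      ring_nf
    _ ≤ _ := by simpa using h1

/-! ### From tail rates to Bahadur slopes and sample sizes -/

lemma testStat_lt_testStat_iff (β₀ : ℝ) (b : Estimator) {n : ℕ} (hn : 1 ≤ n) (x y : Config n) :
    testStat β₀ b n x < testStat β₀ b n y ↔ b n x < b n y := by
  have hs : 0 < Real.sqrt n := Real.sqrt_pos.2 (by exact_mod_cast hn)
  have hmono : StrictMono fun a : EReal => ((Real.sqrt n : ℝ) : EReal) * (a - (β₀ : EReal)) := by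
    intro a c hac
    induction a <;> induction c <;>
      simp_all [EReal.coe_mul_top_of_pos, EReal.coe_mul_bot_of_pos, ← EReal.coe_sub,
        ← EReal.coe_mul, EReal.bot_lt_coe, EReal.coe_lt_top]
  exact hmono.lt_iff_lt

lemma pValue_eq (p : ℕ) (β₀ : ℝ) (b : Estimator) {n : ℕ} (hn : 1 ≤ n) (x : Config n) :
    pValue p β₀ b n x = (law p n β₀).real {y | b n x < b n y} := by
  rw [pValue, nullCDF, ← probReal_compl_eq_one_sub (measurableSet_config _)]
  congr 1
  ext y
  simp [testStat_lt_testStat_iff β₀ b hn]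

/-- Whenever the magnetization of the sample `x` nearly maximizes `H p β`, the event
`b x < b x'` about a second sample `x'` contains the event that the magnetization of `x'` falls in a
neighbourhood of a fixed point where `H p β₀` exceeds `S - ε`, and is contained in the event that
`H p β₀` is at most `S + ε` there. Then the p-value of the test based on `b` is
`exp (n (S - supH p β₀) + o(n))` for typical samples under `β`. -/
def HasTailRate (p : ℕ) (β₀ β : ℝ) (b : Estimator) (S : ℝ) : Prop :=
  ∀ ε : ℝ, 0 < ε → ∃ ρ > 0, ∃ y ∈ Icc (-1 : ℝ) 1, ∃ U ∈ 𝓝 y, S - ε < H p β₀ y ∧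
    ∀ᶠ n : ℕ in atTop, ∀ x : Config n, supH p β - ρ < H p β (avg x) →
      (∀ x', b n x < b n x' → H p β₀ (avg x') ≤ S + ε) ∧
      (∀ x', avg x' ∈ U → b n x < b n x')

lemma HasTailRate.pValue_bounds {p : ℕ} (hp : 1 ≤ p) {β₀ β : ℝ} {b : Estimator} {S : ℝ}
    (h : HasTailRate p β₀ β b S) {ε : ℝ} (hε : 0 < ε) :
    ∃ ρ > 0, ∀ᶠ n : ℕ in atTop, ∀ x : Config n, supH p β - ρ < H p β (avg x) →
      0 < pValue p β₀ b n x ∧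
        |Real.log (pValue p β₀ b n x) / n - (S - supH p β₀)| < ε := by
  obtain ⟨ρ, hρ, y, hy, U, hU, hyS, hev⟩ := h (ε / 4) (by positivity)
  refine ⟨ρ, hρ, ?_⟩
  filter_upwards [hev, law_real_le hp β₀ (show 0 < ε / 4 by positivity),
    le_law_real hp (β := β₀) hy hU (show 0 < ε / 4 by positivity), eventually_ge_atTop 1]
    with n hn h1 h2 hn1 x hx
  obtain ⟨hup, hlow⟩ := hn x hx
  have hn' : (0 : ℝ) < n := by exact_mod_cast hn1
  rw [pValue_eq p β₀ b hn1]
  have h3 := h1 (S + ε / 4) {x' | b n x < b n x'} hup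
  have h4 := h2.trans (measureReal_mono (μ := law p n β₀) (fun x' hx' => hlow x' hx') :
    _ ≤ (law p n β₀).real {x' | b n x < b n x'})
  have hpos := (Real.exp_pos _).trans_le h4
  refine ⟨hpos, ?_⟩
  have h5 := (Real.log_le_iff_le_exp hpos).2 h3
  have h6 := (Real.le_log_iff_exp_le hpos).2 h4
  rw [abs_sub_lt_iff, sub_lt_iff_lt_add, div_lt_iff₀ hn', sub_lt_comm, lt_div_iff₀ hn']
  constructor <;> nlinarith

/-- The exceptional samples have exponentially small probability under the alternative. -/
lemma HasTailRate.law_real_bad_le {p : ℕ} (hp : 1 ≤ p) {β₀ β : ℝ} {b : Estimator} {S : ℝ}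
    (h : HasTailRate p β₀ β b S) {ε : ℝ} (hε : 0 < ε) :
    ∃ ρ > 0, ∀ᶠ n : ℕ in atTop, (law p n β).real {x | 0 < pValue p β₀ b n x ∧
        |Real.log (pValue p β₀ b n x) / n - (S - supH p β₀)| < ε}ᶜ ≤ Real.exp (n * -ρ) := by
  obtain ⟨ρ, hρ, hev⟩ := h.pValue_bounds hp hε
  refine ⟨ρ / 2, by positivity, ?_⟩
  filter_upwards [hev, law_real_le hp β (half_pos hρ)] with n hn h1
  refine (h1 (supH p β - ρ) _ fun x hx => ?_).trans_eq (by ring_nf)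
  by_contra hlt
  exact hx (hn x (not_le.1 hlt))

lemma HasTailRate.hasWeakBahadurSlope {p : ℕ} (hp : 1 ≤ p) {β₀ β : ℝ} {b : Estimator} {S : ℝ}
    (h : HasTailRate p β₀ β b S) :
    HasWeakBahadurSlope p β₀ β b (2 * (supH p β₀ - S)) := by
  intro ε hε
  obtain ⟨ρ, hρ, hev⟩ := h.law_real_bad_le hp hε
  have hc : -(2 * (supH p β₀ - S)) / 2 = S - supH p β₀ := by ring
  rw [hc]
  have hexp : Tendsto (fun n : ℕ => 1 - Real.exp (n * -ρ)) atTop (𝓝 1) := by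
    have h1 : Tendsto (fun n : ℕ => (n : ℝ) * -ρ) atTop atBot :=
      tendsto_natCast_atTop_atTop.atTop_mul_const_of_neg (by linarith)
    simpa using (Real.tendsto_exp_atBot.comp h1).const_sub 1
  refine tendsto_of_tendsto_of_tendsto_of_le_of_le' hexp tendsto_const_nhds ?_
    (Eventually.of_forall fun n => measureReal_le_one)
  filter_upwards [hev] with n hn
  rw [probReal_compl_eq_one_sub (measurableSet_config _)] at hn
  linarith

/-- If `L n = exp (- r n + o(n))`, then the first time after which `L` stays below `δ` is
asymptotic to `- log δ / r`. -/
lemma tendsto_sInf_div_log {L : ℕ → ℝ} {r : ℝ} (hr : 0 < r)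
    (hL : ∀ ε > 0, ∀ᶠ n : ℕ in atTop, 0 < L n ∧ |Real.log (L n) / n - -r| < ε) :
    Tendsto (fun δ : ℝ => ((sInf {N : ℕ | 1 ≤ N ∧ ∀ n, N ≤ n → L n ≤ δ} : ℕ) : ℝ) /
      (Real.log δ / -r)) (𝓝[>] 0) (𝓝 1) := by
  have hlog : Tendsto (fun δ : ℝ => -Real.log δ) (𝓝[>] 0) atTop :=
    tendsto_neg_atBot_atTop.comp Real.tendsto_log_nhdsGT_zero
  -- the two-sided bound at a fixed precision `ε`
  have key : ∀ ε, 0 < ε → ε < r → ∃ n₀ : ℕ, ∀ᶠ δ : ℝ in 𝓝[>] 0,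
      r / (r + ε) ≤ ((sInf {N : ℕ | 1 ≤ N ∧ ∀ n, N ≤ n → L n ≤ δ} : ℕ) : ℝ) / (Real.log δ / -r) ∧
      ((sInf {N : ℕ | 1 ≤ N ∧ ∀ n, N ≤ n → L n ≤ δ} : ℕ) : ℝ) / (Real.log δ / -r) ≤
        r / (r - ε) + r * (1 + n₀) / (-Real.log δ) := by
    intro ε hε hεr
    obtain ⟨n₁, hn₁⟩ := eventually_atTop.1 (hL ε hε)
    obtain ⟨n₀, hn₀, h1n₀⟩ : ∃ n₀, n₁ ≤ n₀ ∧ 1 ≤ n₀ := ⟨max n₁ 1, le_max_left _ _, le_max_right _ _⟩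
    have hb : ∀ n, n₀ ≤ n → 0 < L n ∧ -(r + ε) * n < Real.log (L n) ∧
        Real.log (L n) < -(r - ε) * n := by
      intro n hn
      obtain ⟨h1, h2⟩ := hn₁ n (hn₀.trans hn)
      have hn' : (0 : ℝ) < n := by exact_mod_cast h1n₀.trans hn
      rw [abs_sub_lt_iff, sub_lt_iff_lt_add, div_lt_iff₀ hn', sub_lt_comm, lt_div_iff₀ hn'] at h2
      exact ⟨h1, by linarith [h2.2], by linarith [h2.1]⟩
    refine ⟨n₀, ?_⟩
    filter_upwards [self_mem_nhdsWithin, hlog.eventually_gt_atTop 0,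
      nhdsWithin_le_nhds (gt_mem_nhds (hb n₀ le_rfl).1)] with δ hδ hℓ hδL
    have hδ0 : (0 : ℝ) < δ := hδ
    set ℓ := -Real.log δ with hℓdef
    have hlogδ : Real.log δ = -ℓ := by rw [hℓdef]; ring
    set s := {N : ℕ | 1 ≤ N ∧ ∀ n, N ≤ n → L n ≤ δ} with hs
    have hmem : ⌈ℓ / (r - ε)⌉₊ + n₀ ∈ s := by
      refine ⟨by omega, fun n hn => ?_⟩
      obtain ⟨h1, -, h3⟩ := hb n (by omega)
      rw [← Real.log_le_log_iff h1 hδ0]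
      have h4 : ℓ / (r - ε) ≤ n :=
        (Nat.le_ceil _).trans (by exact_mod_cast (show ⌈ℓ / (r - ε)⌉₊ ≤ n by omega))
      rw [div_le_iff₀ (by linarith)] at h4
      linarith
    have hinf := Nat.sInf_mem ⟨_, hmem⟩
    have hle := Nat.sInf_le hmem
    set N := sInf s
    have hNn₀ : n₀ ≤ N := by
      by_contra hlt
      exact absurd (hinf.2 n₀ (by omega)) (not_le.2 hδL)
    have hN1 : (N : ℝ) ≤ ℓ / (r - ε) + 1 + n₀ := by
      have h1 : (N : ℝ) ≤ ⌈ℓ / (r - ε)⌉₊ + n₀ := by exact_mod_cast hle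
      have h2 := Nat.ceil_lt_add_one (show 0 ≤ ℓ / (r - ε) from div_nonneg hℓ.le (by linarith))
      linarith
    have hN2 : ℓ ≤ (r + ε) * N := by
      obtain ⟨h1, h2, -⟩ := hb N hNn₀
      have h3 := (Real.log_le_log_iff h1 hδ0).2 (hinf.2 N le_rfl)
      linarith
    have hrw : (N : ℝ) / (Real.log δ / -r) = r * N / ℓ := by
      rw [hlogδ]; field_simp
    have hrε : 0 < r - ε := by linarith
    rw [hrw]
    constructor
    · rw [div_le_div_iff₀ (by linarith) hℓ]
      nlinarith
    · calc r * N / ℓ ≤ r * (ℓ / (r - ε) + 1 + n₀) / ℓ := by gcongr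
        _ = _ := by field_simp; ring
  refine tendsto_order.2 ⟨fun a ha => ?_, fun a ha => ?_⟩
  · have h1 : Tendsto (fun ε : ℝ => r / (r + ε)) (𝓝 0) (𝓝 1) := by
      have : ContinuousAt (fun ε : ℝ => r / (r + ε)) 0 :=
        continuousAt_const.div (by fun_prop) (by simpa using hr.ne')
      simpa [ContinuousAt, hr.ne'] using this
    obtain ⟨ε, hε, hε1, hε2⟩ := (((h1.mono_left nhdsWithin_le_nhds).eventually
      (lt_mem_nhds ha)).and (Ioo_mem_nhdsGT hr)).exists
    obtain ⟨n₀, hn₀⟩ := key ε hε1 hε2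
    exact hn₀.mono fun δ hδ => hε.trans_le hδ.1
  · have h1 : Tendsto (fun ε : ℝ => r / (r - ε)) (𝓝 0) (𝓝 1) := by
      have : ContinuousAt (fun ε : ℝ => r / (r - ε)) 0 :=
        continuousAt_const.div (by fun_prop) (by simpa using hr.ne')
      simpa [ContinuousAt, hr.ne'] using this
    obtain ⟨ε, hε, hε1, hε2⟩ := (((h1.mono_left nhdsWithin_le_nhds).eventually
      (gt_mem_nhds ha)).and (Ioo_mem_nhdsGT hr)).exists
    obtain ⟨n₀, hn₀⟩ := key ε hε1 hε2
    have h2 : Tendsto (fun δ : ℝ => r / (r - ε) + r * (1 + n₀) / (-Real.log δ)) (𝓝[>] 0)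
        (𝓝 (r / (r - ε))) := by
      simpa using (hlog.const_div_atTop (r * (1 + n₀))).const_add (r / (r - ε))
    filter_upwards [hn₀, h2.eventually (gt_mem_nhds hε)] with δ hδ h3
    exact hδ.2.trans_lt h3

lemma HasTailRate.hasMinSampleSize {p : ℕ} (hp : 1 ≤ p) {β₀ β : ℝ} {b : Estimator} {S : ℝ}
    (h : HasTailRate p β₀ β b S) (hS : S < supH p β₀) :
    HasMinSampleSize.{u} p β₀ β b (fun δ => Real.log δ / (S - supH p β₀)) := by
  intro Ω _ μ _ X hX
  -- Borel-Cantelli: the samples are eventually typical, for each precision `1 / (j + 1)`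
  have hae : ∀ j : ℕ, ∀ᵐ ω ∂μ, ∀ᶠ n : ℕ in atTop, 0 < pValue p β₀ b n (X n ω) ∧
      |Real.log (pValue p β₀ b n (X n ω)) / n - (S - supH p β₀)| < 1 / ((j : ℝ) + 1) := by
    intro j
    obtain ⟨ρ, hρ, hev⟩ := h.law_real_bad_le hp (show 0 < 1 / ((j : ℝ) + 1) by positivity)
    set B : (n : ℕ) → Set (Config n) := fun n => {x | 0 < pValue p β₀ b n x ∧
      |Real.log (pValue p β₀ b n x) / n - (S - supH p β₀)| < 1 / ((j : ℝ) + 1)}ᶜ with hB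
    have hsum : Summable fun n => μ.real {ω | X n ω ∈ B n} := by
      refine Summable.of_norm_bounded_eventually_nat (Real.summable_exp_nat_mul_iff.2
        (show -ρ < 0 by linarith)) ?_
      filter_upwards [hev] with n hn
      rw [Real.norm_of_nonneg measureReal_nonneg,
        (hX n).measureReal_eq (p := fun x => x ∈ B n) (measurableSet_config _)]
      exact hn
    have hfin : ∑' n, μ {ω | X n ω ∈ B n} ≠ ⊤ := by
      have h1 : ∀ n, μ {ω | X n ω ∈ B n} = ENNReal.ofReal (μ.real {ω | X n ω ∈ B n}) :=
        fun n => (ofReal_measureReal).symm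
      simp_rw [h1]
      exact hsum.tsum_ofReal_ne_top
    filter_upwards [ae_eventually_notMem hfin] with ω hω
    filter_upwards [hω] with n hn
    simpa [hB] using hn
  filter_upwards [ae_all_iff.2 hae] with ω hω
  have := tendsto_sInf_div_log (L := fun n => pValue p β₀ b n (X n ω))
    (r := supH p β₀ - S) (by linarith) fun ε hε => by
      obtain ⟨j, hj⟩ := exists_nat_one_div_lt hε
      filter_upwards [hω j] with n hn
      rw [neg_sub]
      exact ⟨hn.1, hn.2.trans hj⟩
  simpa only [neg_sub, minSampleSize] using this

/-! ### The shape of `η` and of `H` -/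

/-- The real-valued version of `η` on `(0, 1)`. -/
def etaReal (p : ℕ) (x : ℝ) : ℝ := Real.artanh x / (p * x ^ (p - 1))

/-- The point of `[0, 1]` where `η` turns from decreasing to increasing: the derivative of `η` on
`(0, 1)` has the sign of `x / (1 - x ^ 2) - (p - 1) artanh x`. -/
def turn (p : ℕ) : ℝ :=
  sSup {x : ℝ | x ∈ Ico (0 : ℝ) 1 ∧ x / (1 - x ^ 2) - ((p : ℝ) - 1) * Real.artanh x ≤ 0}

lemma artanh_eq_log_sub_log {x : ℝ} (hx : x ∈ Ioo (-1 : ℝ) 1) :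
    Real.artanh x = (Real.log (1 + x) - Real.log (1 - x)) / 2 := by
  rw [Real.artanh_eq_half_log (Ioo_subset_Icc_self hx),
    Real.log_div (by linarith [hx.1]) (by linarith [hx.2])]
  ring

lemma hasDerivAt_artanh {x : ℝ} (hx : x ∈ Ioo (-1 : ℝ) 1) :
    HasDerivAt Real.artanh (1 / (1 - x ^ 2)) x := by
  have h1 : (1 + x) ≠ 0 := by linarith [hx.1]
  have h2 : (1 - x) ≠ 0 := by linarith [hx.2]
  have h3 : (1 - x ^ 2) ≠ 0 := by
    rw [show 1 - x ^ 2 = (1 + x) * (1 - x) by ring]; exact mul_ne_zero h1 h2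
  have h := ((((hasDerivAt_id x).const_add 1).log h1).sub
    (((hasDerivAt_id x).const_sub 1).log h2)).div_const 2
  refine (h.congr_of_eventuallyEq ?_).congr_deriv ?_
  · filter_upwards [isOpen_Ioo.mem_nhds hx] with y hy
    simpa using artanh_eq_log_sub_log hy
  · simp only [id]
    field_simp
    ring

lemma hasDerivAt_H (p : ℕ) (β : ℝ) {x : ℝ} (hx : x ∈ Ioo (-1 : ℝ) 1) :
    HasDerivAt (H p β) (β * (p * x ^ (p - 1)) - Real.artanh x) x := by
  have h1 : (1 + x) ≠ 0 := by linarith [hx.1]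
  have h2 : (1 - x) ≠ 0 := by linarith [hx.2]
  have h := ((hasDerivAt_pow p x).const_mul β).sub
    (((((hasDerivAt_id x).const_add 1).mul (((hasDerivAt_id x).const_add 1).log h1)).add
    (((hasDerivAt_id x).const_sub 1).mul (((hasDerivAt_id x).const_sub 1).log h2))).div_const 2)
  refine h.congr_deriv ?_
  rw [artanh_eq_log_sub_log hx]
  simp only [id]
  field_simp
  ring

lemma hasDerivAt_slope (a : ℝ) {x : ℝ} (hx : x ∈ Ioo (-1 : ℝ) 1) :
    HasDerivAt (fun x => x / (1 - x ^ 2) - (a - 1) * Real.artanh x)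
      ((a * x ^ 2 - (a - 2)) / (1 - x ^ 2) ^ 2) x := by
  have h3 : (1 - x ^ 2) ≠ 0 := by nlinarith [hx.1, hx.2]
  have h := ((hasDerivAt_id x).div ((hasDerivAt_pow 2 x).const_sub 1) h3).sub
    ((hasDerivAt_artanh hx).const_mul (a - 1))
  refine h.congr_deriv ?_
  simp only [id]
  field_simp
  push_cast
  ring

lemma slope_strictAntiOn {a : ℝ} (ha : 2 ≤ a) :
    StrictAntiOn (fun x => x / (1 - x ^ 2) - (a - 1) * Real.artanh x)
      (Icc 0 (Real.sqrt ((a - 2) / a))) := by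
  have hlt : Real.sqrt ((a - 2) / a) < 1 := by
    rw [Real.sqrt_lt' one_pos, div_lt_iff₀ (by linarith)]; linarith
  refine strictAntiOn_of_deriv_neg (convex_Icc _ _) (fun x hx =>
    (hasDerivAt_slope a ⟨by linarith [hx.1], hx.2.trans_lt hlt⟩).continuousAt.continuousWithinAt)
    fun x hx => ?_
  rw [interior_Icc] at hx
  rw [(hasDerivAt_slope a ⟨by linarith [hx.1], hx.2.trans hlt⟩).deriv]
  have h1 : x ^ 2 < (a - 2) / a := (Real.lt_sqrt hx.1.le).1 hx.2
  rw [lt_div_iff₀ (by linarith)] at h1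
  have h3 : 0 < 1 - x ^ 2 := by nlinarith [hx.1, hx.2.trans hlt]
  exact div_neg_of_neg_of_pos (by linarith) (by positivity)

lemma slope_strictMonoOn {a : ℝ} (ha : 2 ≤ a) :
    StrictMonoOn (fun x => x / (1 - x ^ 2) - (a - 1) * Real.artanh x)
      (Ico (Real.sqrt ((a - 2) / a)) 1) := by
  have h0 := Real.sqrt_nonneg ((a - 2) / a)
  refine strictMonoOn_of_deriv_pos (convex_Ico _ _) (fun x hx =>
    (hasDerivAt_slope a ⟨by linarith [hx.1], hx.2⟩).continuousAt.continuousWithinAt)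
    fun x hx => ?_
  rw [interior_Ico] at hx
  rw [(hasDerivAt_slope a ⟨by linarith [hx.1], hx.2⟩).deriv]
  have h1 : (a - 2) / a < x ^ 2 := (Real.sqrt_lt' (h0.trans_lt hx.1)).1 hx.1
  rw [div_lt_iff₀ (by linarith)] at h1
  have h3 : 0 < 1 - x ^ 2 := by nlinarith [hx.1, hx.2]
  exact div_pos (by linarith) (by positivity)

lemma turn_set_bddAbove (p : ℕ) : BddAbove {x : ℝ | x ∈ Ico (0 : ℝ) 1 ∧
    x / (1 - x ^ 2) - ((p : ℝ) - 1) * Real.artanh x ≤ 0} := ⟨1, fun _ hx => hx.1.2.le⟩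

lemma zero_mem_turn_set (p : ℕ) : (0 : ℝ) ∈ {x : ℝ | x ∈ Ico (0 : ℝ) 1 ∧
    x / (1 - x ^ 2) - ((p : ℝ) - 1) * Real.artanh x ≤ 0} := by simp

lemma turn_nonneg (p : ℕ) : 0 ≤ turn p := le_csSup (turn_set_bddAbove p) (zero_mem_turn_set p)

lemma turn_two : turn 2 = 0 := by
  refine le_antisymm (csSup_le ⟨0, zero_mem_turn_set 2⟩ fun x hx => ?_) (turn_nonneg 2)
  by_contra! h
  have := slope_strictMonoOn (a := 2) le_rfl (show (0 : ℝ) ∈ _ by simp)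
    (show x ∈ _ by simpa using hx.1) h
  have h2 := hx.2
  push_cast at h2
  simp only [Real.artanh_zero] at this
  linarith

lemma slope_pos_of_turn_lt {p : ℕ} {x : ℝ} (hx : x ∈ Ioo (0 : ℝ) 1) (h : turn p < x) :
    0 < x / (1 - x ^ 2) - ((p : ℝ) - 1) * Real.artanh x := by
  by_contra! hle
  exact absurd (le_csSup (turn_set_bddAbove p) ⟨⟨hx.1.le, hx.2⟩, hle⟩) (not_le.2 h)

lemma slope_neg_of_lt_turn {p : ℕ} (hp : 2 ≤ p) {x : ℝ} (hx : x ∈ Ioo (0 : ℝ) 1) (h : x < turn p) :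
    x / (1 - x ^ 2) - ((p : ℝ) - 1) * Real.artanh x < 0 := by
  have ha : (2 : ℝ) ≤ p := by exact_mod_cast hp
  obtain ⟨y, hy, hxy⟩ := exists_lt_of_lt_csSup ⟨0, zero_mem_turn_set p⟩ h
  rcases le_total x (Real.sqrt (((p : ℝ) - 2) / p)) with hc | hc
  · have := slope_strictAntiOn ha ⟨le_rfl, Real.sqrt_nonneg _⟩ ⟨hx.1.le, hc⟩ hx.1
    simpa using this
  · exact (slope_strictMonoOn ha ⟨hc, hx.2⟩ ⟨hc.trans hxy.le, hy.1.2⟩ hxy).trans_le hy.2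

lemma hasDerivAt_etaReal {p : ℕ} (hp : 2 ≤ p) {x : ℝ} (hx : x ∈ Ioo (0 : ℝ) 1) :
    HasDerivAt (etaReal p)
      ((x / (1 - x ^ 2) - ((p : ℝ) - 1) * Real.artanh x) / (p * x ^ p)) x := by
  obtain ⟨q, rfl⟩ := Nat.exists_eq_add_of_le' hp
  have hx' : x ∈ Ioo (-1 : ℝ) 1 := ⟨by linarith [hx.1], hx.2⟩
  have hx0 : x ≠ 0 := hx.1.ne'
  have h3 : (1 - x ^ 2) ≠ 0 := by nlinarith [hx.1, hx.2]
  have hq : (q : ℝ) + 2 ≠ 0 := by positivity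
  have hd : ((q + 2 : ℕ) : ℝ) * x ^ (q + 2 - 1) ≠ 0 := by push_cast; positivity
  have h := (hasDerivAt_artanh hx').div
    ((hasDerivAt_pow (q + 2 - 1) x).const_mul ((q + 2 : ℕ) : ℝ)) hd
  refine h.congr_deriv ?_
  simp only [show q + 2 - 1 = q + 1 by omega, Nat.add_sub_cancel]
  push_cast
  field_simp
  ring

lemma continuousOn_etaReal {p : ℕ} (hp : 2 ≤ p) : ContinuousOn (etaReal p) (Ioo 0 1) :=
  fun _ hx => (hasDerivAt_etaReal hp hx).continuousAt.continuousWithinAt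

lemma etaReal_strictAntiOn {p : ℕ} (hp : 2 ≤ p) :
    StrictAntiOn (etaReal p) (Ioo 0 1 ∩ Iic (turn p)) := by
  refine strictAntiOn_of_deriv_neg ((convex_Ioo _ _).inter (convex_Iic _))
    ((continuousOn_etaReal hp).mono inter_subset_left) fun x hx => ?_
  rw [interior_inter, interior_Ioo, interior_Iic] at hx
  rw [(hasDerivAt_etaReal hp hx.1).deriv]
  have := hx.1.1
  exact div_neg_of_neg_of_pos (slope_neg_of_lt_turn hp hx.1 hx.2) (by positivity)

lemma etaReal_strictMonoOn {p : ℕ} (hp : 2 ≤ p) :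
    StrictMonoOn (etaReal p) (Ioo 0 1 ∩ Ici (turn p)) := by
  refine strictMonoOn_of_deriv_pos ((convex_Ioo _ _).inter (convex_Ici _))
    ((continuousOn_etaReal hp).mono inter_subset_left) fun x hx => ?_
  rw [interior_inter, interior_Ioo, interior_Ici] at hx
  rw [(hasDerivAt_etaReal hp hx.1).deriv]
  have := hx.1.1
  exact div_pos (slope_pos_of_turn_lt hx.1 hx.2) (by positivity)

lemma H_zero {p : ℕ} (hp : 2 ≤ p) (β : ℝ) : H p β 0 = 0 := by
  have : p ≠ 0 := by omega
  simp [H, this]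

lemma deriv_H_neg {p : ℕ} (hp : 2 ≤ p) {β x : ℝ} (hx : x ∈ Ioo (0 : ℝ) 1) (h : β < etaReal p x) :
    deriv (H p β) x < 0 := by
  rw [(hasDerivAt_H p β ⟨by linarith [hx.1], hx.2⟩).deriv]
  have := hx.1
  rw [etaReal, lt_div_iff₀ (by positivity)] at h
  linarith

/-- `H p β` decreases to the right of the point of the increasing branch of `η` with value `β`. -/
lemma H_strictAntiOn_right {p : ℕ} (hp : 2 ≤ p) {β m : ℝ} (hm : m ∈ Ioo (0 : ℝ) 1)
    (hc : turn p ≤ m) (hβ : etaReal p m = β) : StrictAntiOn (H p β) (Icc m 1) := by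
  refine strictAntiOn_of_deriv_neg (convex_Icc _ _) (continuous_H p β).continuousOn fun x hx => ?_
  rw [interior_Icc] at hx
  have hx1 : x ∈ Ioo (0 : ℝ) 1 := ⟨hm.1.trans hx.1, hx.2⟩
  refine deriv_H_neg hp hx1 ?_
  rw [← hβ]
  exact etaReal_strictMonoOn hp ⟨hm, hc⟩ ⟨hx1, hc.trans hx.1.le⟩ hx.1

/-- On the decreasing branch of `η`, the function `H p β` is negative where `η ≥ β`. -/
lemma H_neg_of_le_turn {p : ℕ} (hp : 2 ≤ p) {β y : ℝ} (hy : y ∈ Ioo (0 : ℝ) 1)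
    (hc : y ≤ turn p) (hβ : β ≤ etaReal p y) : H p β y < 0 := by
  have : StrictAntiOn (H p β) (Icc 0 y) := by
    refine strictAntiOn_of_deriv_neg (convex_Icc _ _) (continuous_H p β).continuousOn fun x hx => ?_
    rw [interior_Icc] at hx
    have hx1 : x ∈ Ioo (0 : ℝ) 1 := ⟨hx.1, hx.2.trans hy.2⟩
    exact deriv_H_neg hp hx1
      (hβ.trans_lt (etaReal_strictAntiOn hp ⟨hx1, hx.2.le.trans hc⟩ ⟨hy, hc⟩ hx.2))
  have h := this ⟨le_rfl, hy.1.le⟩ ⟨hy.1.le, le_rfl⟩ hy.1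
  rwa [H_zero hp] at h

lemma le_etaReal_iff {p : ℕ} (hp : 2 ≤ p) {y : ℝ} (hy : y ∈ Ioo (0 : ℝ) 1) (t : ℝ) :
    t ≤ etaReal p y ↔ (1 - y) * Real.exp (2 * (t * (p * y ^ (p - 1)))) ≤ 1 + y := by
  have h1 : 0 < 1 - y := by linarith [hy.2]
  have h2 : 0 < 1 + y := by linarith [hy.1]
  have h3 := hy.1
  rw [etaReal, le_div_iff₀ (by positivity), Real.artanh_eq_half_log ⟨by linarith, by linarith⟩,
    mul_comm (1 - y), ← le_div_iff₀ h1, ← Real.le_log_iff_exp_le (by positivity)]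
  constructor <;> intro h <;> linarith

/-! ### The maximizers of `H` -/

/-- The magnetization modulo the symmetry of the model, which is `x ↦ -x` for even `p` and trivial
for odd `p`. -/
def fold (p : ℕ) (x : ℝ) : ℝ := if Even p then |x| else x

lemma fold_pow (p : ℕ) (x : ℝ) : fold p x ^ p = x ^ p := by
  unfold fold
  split_ifs with h
  · exact h.pow_abs x
  · rfl

lemma H_abs {p : ℕ} (h : Even p) (β x : ℝ) : H p β |x| = H p β x := by
  rcases abs_choice x with hx | hx <;> rw [hx]
  rw [H, H, h.neg_pow]
  ring_nf

lemma H_fold (p : ℕ) (β x : ℝ) : H p β (fold p x) = H p β x := by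
  unfold fold
  split_ifs with h
  · exact H_abs h β x
  · rfl

lemma fold_mem_Icc {p : ℕ} {x : ℝ} (hx : x ∈ Icc (-1 : ℝ) 1) : fold p x ∈ Icc (-1 : ℝ) 1 := by
  unfold fold
  split_ifs
  · exact ⟨by linarith [abs_nonneg x], abs_le.2 hx⟩
  · exact hx

lemma continuous_fold (p : ℕ) : Continuous (fold p) := by
  unfold fold
  split_ifs
  · exact continuous_abs
  · exact continuous_id

lemma betaStar_nonneg (p : ℕ) : 0 ≤ betaStar p := Real.sSup_nonneg fun _ hx => hx.1

lemma supH_pos {p : ℕ} (hp : 2 ≤ p) {β : ℝ} (hβ : betaStar p < β) : 0 < supH p β := by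
  have h0 : 0 ≤ supH p β := by
    rw [← H_zero hp β]; exact H_le_supH p β (by norm_num)
  refine lt_of_le_of_ne h0 fun h => ?_
  have hbdd : BddAbove {β : ℝ | 0 ≤ β ∧ supH p β = 0} := by
    refine ⟨Real.log 2, fun b hb => ?_⟩
    have := H_le_supH p b (x := 1) (by norm_num)
    rw [hb.2, H] at this
    norm_num at this
    linarith
  exact absurd (le_csSup hbdd ⟨(betaStar_nonneg p).trans hβ.le, h.symm⟩) (not_le.2 hβ)

/-- A positive maximizer of `H p β` is interior and lies on the increasing branch of `η`. -/
lemma maximizer_spec {p : ℕ} (hp : 2 ≤ p) {β : ℝ} (hβ : betaStar p < β) {x : ℝ} (hx0 : 0 < x)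
    (hx1 : x ≤ 1) (hx : H p β x = supH p β) :
    x < 1 ∧ turn p < x ∧ etaReal p x = β := by
  have hβ0 : 0 < β := (betaStar_nonneg p).trans_lt hβ
  have hp0 : (0 : ℝ) < p := by positivity
  have hlt1 : x < 1 := by
    refine lt_of_le_of_ne hx1 fun h => ?_
    subst h
    -- near `1` the derivative of `H` is negative, because `artanh` exceeds `p β` there
    set z := Real.tanh (p * β)
    have hz : z ∈ Ioo (-1 : ℝ) 1 := ⟨Real.neg_one_lt_tanh _, Real.tanh_lt_one _⟩
    have hz0 : 0 ≤ z := by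
      by_contra! hneg
      have := Real.artanh_neg ⟨hz.1, hneg⟩
      rw [Real.artanh_tanh] at this
      nlinarith
    have hanti : StrictAntiOn (H p β) (Icc z 1) := by
      refine strictAntiOn_of_deriv_neg (convex_Icc _ _) (continuous_H p β).continuousOn
        fun y hy => ?_
      rw [interior_Icc] at hy
      have hy1 : y ∈ Ioo (-1 : ℝ) 1 := ⟨hz.1.trans hy.1, hy.2⟩
      rw [(hasDerivAt_H p β hy1).deriv]
      have h1 := Real.strictMonoOn_artanh hz hy1 hy.1
      rw [Real.artanh_tanh] at h1
      have h2 : y ^ (p - 1) ≤ 1 := pow_le_one₀ (hz0.trans hy.1.le) hy.2.le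
      have h3 : β * (p * y ^ (p - 1)) ≤ p * β := by
        calc β * (p * y ^ (p - 1)) ≤ β * (p * 1) := by gcongr
          _ = p * β := by ring
      linarith
    have h1 := hanti ⟨le_rfl, hz.2.le⟩ ⟨hz.2.le, le_rfl⟩ hz.2
    have h2 := H_le_supH p β (Ioo_subset_Icc_self hz)
    linarith
  have hxI : x ∈ Ioo (0 : ℝ) 1 := ⟨hx0, hlt1⟩
  have hη : etaReal p x = β := by
    have hmax : IsLocalMax (H p β) x := by
      filter_upwards [isOpen_Ioo.mem_nhds hxI] with y hy
      rw [hx]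
      exact H_le_supH p β ⟨by linarith [hy.1], hy.2.le⟩
    have h0 := hmax.hasDerivAt_eq_zero (hasDerivAt_H p β ⟨by linarith, hlt1⟩)
    rw [etaReal, div_eq_iff (by positivity)]
    linarith
  refine ⟨hlt1, ?_, hη⟩
  by_contra! hle
  have := H_neg_of_le_turn hp hxI hle hη.ge
  linarith [supH_pos hp hβ]

lemma fold_maximizer_pos {p : ℕ} (hp : 2 ≤ p) {β : ℝ} (hβ : betaStar p < β) {x : ℝ}
    (hxI : x ∈ Icc (-1 : ℝ) 1) (hx : H p β x = supH p β) : 0 < fold p x := by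
  have hβ0 : 0 < β := (betaStar_nonneg p).trans_lt hβ
  have hx0 : x ≠ 0 := by
    rintro rfl
    rw [H_zero hp] at hx
    exact (supH_pos hp hβ).ne hx
  unfold fold
  split_ifs with h
  · exact abs_pos.2 hx0
  · rw [Nat.not_even_iff_odd] at h
    by_contra! hle
    have hneg : x < 0 := lt_of_le_of_ne hle hx0
    have h1 := H_le_supH p β (x := -x) ⟨by linarith [hxI.2], by linarith [hxI.1]⟩
    have h2 : H p β (-x) = H p β x - 2 * (β * x ^ p) := by
      rw [H, H, h.neg_pow]; ring_nf
    have h3 : x ^ p < 0 := h.pow_neg hneg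
    nlinarith

/-- For `β` above the threshold, `mStar p β` is a maximizer of `H p β`, it lies on the increasing
branch of `η`, and it is the only maximizer up to symmetry. -/
lemma mStar_spec {p : ℕ} (hp : 2 ≤ p) {β : ℝ} (hβ : betaStar p < β) :
    mStar p β ∈ Ioo (0 : ℝ) 1 ∧ turn p < mStar p β ∧ etaReal p (mStar p β) = β ∧
      H p β (mStar p β) = supH p β ∧
      ∀ x ∈ Icc (-1 : ℝ) 1, H p β x = supH p β → fold p x = mStar p β := by
  obtain ⟨x, hxI, hx⟩ := exists_H_eq_supH p β
  have hpos := fold_maximizer_pos hp hβ hxI hx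
  have hm1 := (fold_mem_Icc (p := p) hxI).2
  have hH : H p β (fold p x) = supH p β := by rw [H_fold, hx]
  set m := fold p x
  obtain ⟨hlt, hc, hη⟩ := maximizer_spec hp hβ hpos hm1 hH
  have huniq : ∀ y, 0 < y → y ≤ 1 → H p β y = supH p β → y = m := by
    intro y hy0 hy1 hy
    obtain ⟨hylt, hyc, hyη⟩ := maximizer_spec hp hβ hy0 hy1 hy
    exact (etaReal_strictMonoOn hp).injOn ⟨⟨hy0, hylt⟩, hyc.le⟩ ⟨⟨hpos, hlt⟩, hc.le⟩
      (hyη.trans hη.symm)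
  have hset : {x : ℝ | 0 < x ∧ x ≤ 1 ∧ IsMaxOn (H p β) (Icc (-1) 1) x} = {m} := by
    ext y
    simp only [mem_ofPred_eq, mem_singleton_iff]
    constructor
    · rintro ⟨h0, h1, hmax⟩
      refine huniq y h0 h1 (le_antisymm (H_le_supH p β ⟨by linarith, h1⟩) ?_)
      rw [← hx]
      exact hmax hxI
    · rintro rfl
      refine ⟨hpos, hm1, fun z hz => ?_⟩
      rw [mem_ofPred_eq, hH]
      exact H_le_supH p β hz
  have hmS : mStar p β = m := by rw [mStar, hset, csSup_singleton]
  rw [hmS]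
  refine ⟨⟨hpos, hlt⟩, hc, hη, hH, fun y hy hyH => ?_⟩
  exact huniq _ (fold_maximizer_pos hp hβ hy hyH) (fold_mem_Icc hy).2 (by rw [H_fold, hyH])

lemma mStar_lt_mStar {p : ℕ} (hp : 2 ≤ p) {β₀ β : ℝ} (hβ₀ : betaStar p < β₀) (hβ : β₀ < β) :
    mStar p β₀ < mStar p β := by
  obtain ⟨h1, h2, h3, -⟩ := mStar_spec hp hβ₀
  obtain ⟨h1', h2', h3', -⟩ := mStar_spec hp (hβ₀.trans hβ)
  rwa [← (etaReal_strictMonoOn hp).lt_iff_lt ⟨h1, h2.le⟩ ⟨h1', h2'.le⟩, h3, h3']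

lemma H_strictAntiOn_mStar {p : ℕ} (hp : 2 ≤ p) {β : ℝ} (hβ : betaStar p < β) :
    StrictAntiOn (H p β) (Icc (mStar p β) 1) :=
  let ⟨h1, h2, h3, _⟩ := mStar_spec hp hβ
  H_strictAntiOn_right hp h1 h2.le h3

/-- Near-maximizers of `H p β` are, up to symmetry, near `mStar p β`. -/
lemma exists_near_mStar {p : ℕ} (hp : 2 ≤ p) {β : ℝ} (hβ : betaStar p < β) {V : Set ℝ}
    (hV : V ∈ 𝓝 (mStar p β)) :
    ∃ ρ > 0, ∀ x ∈ Icc (-1 : ℝ) 1, supH p β - ρ < H p β x → fold p x ∈ V := by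
  set K := Icc (-1 : ℝ) 1 ∩ (fold p ⁻¹' interior V)ᶜ
  have hK : IsCompact K := isCompact_Icc.inter_right
    (isOpen_interior.preimage (continuous_fold p)).isClosed_compl
  rcases K.eq_empty_or_nonempty with he | hne
  · refine ⟨1, one_pos, fun x hx _ => ?_⟩
    by_contra h
    have : x ∈ K := ⟨hx, fun h' => h (interior_subset h')⟩
    simp [he] at this
  · obtain ⟨z, hz, hmax⟩ := hK.exists_isMaxOn hne (continuous_H p β).continuousOn
    have hlt : H p β z < supH p β := by
      refine lt_of_le_of_ne (H_le_supH p β hz.1) fun h => hz.2 ?_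
      rw [mem_preimage, (mStar_spec hp hβ).2.2.2.2 z hz.1 h]
      exact mem_interior_iff_mem_nhds.2 hV
    refine ⟨supH p β - H p β z, by linarith, fun x hx hxH => ?_⟩
    by_contra h
    have := hmax (show x ∈ K from ⟨hx, fun h' => h (interior_subset h')⟩)
    simp only [mem_ofPred_eq] at this
    linarith

/-- Above `β₀`, the set `η ≥ η(m₁)` consists of `[m₁, 1]` and, if `p ≠ 2`, of points near
zero where `H p β₀` is nonpositive. -/
lemma le_or_H_nonpos {p : ℕ} (hp : 2 ≤ p) {β₀ m₁ y : ℝ} (hβ₀ : betaStar p < β₀)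
    (hm₁ : mStar p β₀ ≤ m₁) (hm₁1 : m₁ < 1) (hy : y ∈ Ioc (0 : ℝ) 1)
    (h : (1 - y) * Real.exp (2 * (etaReal p m₁ * (p * y ^ (p - 1)))) ≤ 1 + y) :
    m₁ ≤ y ∨ (p ≠ 2 ∧ H p β₀ y ≤ 0) := by
  obtain ⟨h1, h2, h3, -⟩ := mStar_spec hp hβ₀
  by_contra! hcon
  obtain ⟨hlt, hH⟩ := hcon
  have hyI : y ∈ Ioo (0 : ℝ) 1 := ⟨hy.1, hlt.trans hm₁1⟩
  have hm₁I : m₁ ∈ Ioo (0 : ℝ) 1 := ⟨h1.1.trans_le hm₁, hm₁1⟩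
  have hη := (le_etaReal_iff hp hyI _).2 h
  have hyc : y < turn p := by
    by_contra! hc
    exact absurd (etaReal_strictMonoOn hp ⟨hyI, hc⟩ ⟨hm₁I, h2.le.trans hm₁⟩ hlt) (not_lt.2 hη)
  have hp2 : p ≠ 2 := by
    rintro rfl
    rw [turn_two] at hyc
    exact absurd hyc (not_lt.2 hy.1.le)
  have hle : β₀ ≤ etaReal p m₁ := by
    rw [← h3]
    exact (etaReal_strictMonoOn hp).monotoneOn ⟨h1, h2.le⟩ ⟨hm₁I, h2.le.trans hm₁⟩ hm₁
  exact absurd (H_neg_of_le_turn hp hyI hyc.le (hle.trans hη)) (not_lt.2 (hH hp2).le)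

/-! ### Maximizers over the extended real line -/

lemma comap_coe_nhds_neBot (b : EReal) : (comap (fun β : ℝ => (β : EReal)) (𝓝 b)).NeBot := by
  have hd : DenseRange (fun β : ℝ => (β : EReal)) := dense_of_exists_between fun a c hac => by
    obtain ⟨r, h1, h2⟩ := EReal.lt_iff_exists_real_btwn.1 hac
    exact ⟨_, mem_range_self r, h1, h2⟩
  exact IsDenseInducing.comap_nhds_neBot ⟨EReal.isEmbedding_coe.isInducing, hd⟩ b

lemma IsExtendedArgmax.le_of_coe {f : ℝ → ℝ} (hf : Continuous f) {r : ℝ}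
    (h : IsExtendedArgmax f (r : EReal)) (β : ℝ) : f β ≤ f r := by
  obtain ⟨s, hs, hlim⟩ := h
  rw [← EReal.isEmbedding_coe.nhds_eq_comap] at hlim
  rw [tendsto_nhds_unique hf.continuousAt hlim]
  exact hs.1 (mem_range_self β)

lemma IsExtendedArgmax.le_of_antitoneOn {f : ℝ → ℝ} {b : EReal} (h : IsExtendedArgmax f b)
    {t a : ℝ} (hf : AntitoneOn f (Ici t)) (ha : f t < f a) : b ≤ t := by
  obtain ⟨s, hs, hlim⟩ := h
  by_contra! hlt
  have := comap_coe_nhds_neBot b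
  have h1 : s ≤ f t := by
    refine le_of_tendsto hlim ?_
    filter_upwards [preimage_mem_comap (lt_mem_nhds hlt)] with β hβ
    have hβ' : t ≤ β := (EReal.coe_lt_coe_iff.1 hβ).le
    exact hf self_mem_Ici hβ' hβ'
  linarith [hs.1 (mem_range_self a)]

lemma IsExtendedArgmax.ge_of_monotoneOn {f : ℝ → ℝ} {b : EReal} (h : IsExtendedArgmax f b)
    {t a : ℝ} (hf : MonotoneOn f (Iic t)) (ha : f t < f a) : (t : EReal) ≤ b := by
  obtain ⟨s, hs, hlim⟩ := h
  by_contra! hlt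
  have := comap_coe_nhds_neBot b
  have h1 : s ≤ f t := by
    refine le_of_tendsto hlim ?_
    filter_upwards [preimage_mem_comap (gt_mem_nhds hlt)] with β hβ
    have hβ' : β ≤ t := (EReal.coe_lt_coe_iff.1 hβ).le
    exact hf hβ' self_mem_Iic hβ'
  linarith [hs.1 (mem_range_self a)]

/-! ### The maximum likelihood estimator -/

lemma pmf_eq_pmf_mul (p : ℕ) {n : ℕ} (β : ℝ) (x y : Config n) :
    pmf p β y = pmf p β x * Real.exp (β * (hamiltonian p y - hamiltonian p x)) := by
  rw [pmf_eq, pmf_eq, div_mul_eq_mul_div, ← Real.exp_add]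
  ring_nf

lemma pmf_le_one (p : ℕ) {n : ℕ} (β : ℝ) (x : Config n) : pmf p β x ≤ 1 := by
  rw [← sum_pmf p n β]
  exact Finset.single_le_sum (f := fun x => pmf p β x) (fun y _ => (pmf_pos p β y).le)
    (Finset.mem_univ x)

lemma differentiable_pmf (p : ℕ) {n : ℕ} (x : Config n) : Differentiable ℝ fun β => pmf p β x := by
  simp_rw [pmf_eq]
  refine Differentiable.div (by fun_prop) (by fun_prop) fun β => ?_
  exact (Finset.sum_pos (fun _ _ => Real.exp_pos _) ⟨fun _ => 1, Finset.mem_univ _⟩).ne'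

lemma IsMLE.ne_top {p n : ℕ} {x y : Config n} (h : hamiltonian p x < hamiltonian p y) {b : EReal}
    (hb : IsMLE p x b) : b ≠ ⊤ := by
  rintro rfl
  obtain ⟨s, hs, hlim⟩ := hb
  have := comap_coe_nhds_neBot ⊤
  have hpos : 0 < s := (pmf_pos p 0 x).trans_le (hs.1 (mem_range_self 0))
  have htop : Tendsto (fun β : ℝ => β) (comap (fun β : ℝ => (β : EReal)) (𝓝 ⊤)) atTop :=
    tendsto_atTop.2 fun a => by
      filter_upwards [preimage_mem_comap (lt_mem_nhds (EReal.coe_lt_top a))] with β hβ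
      exact (EReal.coe_lt_coe_iff.1 hβ).le
  have h0 : Tendsto (fun β : ℝ => Real.exp (β * (hamiltonian p x - hamiltonian p y)))
      (comap (fun β : ℝ => (β : EReal)) (𝓝 ⊤)) (𝓝 0) :=
    Real.tendsto_exp_atBot.comp (htop.atTop_mul_const_of_neg (by linarith))
  refine hpos.not_ge (le_of_tendsto_of_tendsto' hlim h0 fun β => ?_)
  rw [pmf_eq_pmf_mul p β y x]
  exact mul_le_of_le_one_left (Real.exp_pos _).le (pmf_le_one p β y)

lemma IsMLE.ne_bot {p n : ℕ} {x y : Config n} (h : hamiltonian p x < hamiltonian p y) {b : EReal}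
    (hb : IsMLE p y b) : b ≠ ⊥ := by
  rintro rfl
  obtain ⟨s, hs, hlim⟩ := hb
  have := comap_coe_nhds_neBot ⊥
  have hpos : 0 < s := (pmf_pos p 0 y).trans_le (hs.1 (mem_range_self 0))
  have hbot : Tendsto (fun β : ℝ => β) (comap (fun β : ℝ => (β : EReal)) (𝓝 ⊥)) atBot :=
    tendsto_atBot.2 fun a => by
      filter_upwards [preimage_mem_comap (gt_mem_nhds (EReal.bot_lt_coe a))] with β hβ
      exact (EReal.coe_lt_coe_iff.1 hβ).le
  have h0 : Tendsto (fun β : ℝ => Real.exp (β * (hamiltonian p y - hamiltonian p x)))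
      (comap (fun β : ℝ => (β : EReal)) (𝓝 ⊥)) (𝓝 0) :=
    Real.tendsto_exp_atBot.comp (hbot.atBot_mul_const (by linarith))
  refine hpos.not_ge (le_of_tendsto_of_tendsto' hlim h0 fun β => ?_)
  rw [pmf_eq_pmf_mul p β x y]
  exact mul_le_of_le_one_left (Real.exp_pos _).le (pmf_le_one p β x)

/-- The maximum likelihood estimate is a strictly increasing function of the sufficient
statistic. -/
lemma IsMLE.lt {p n : ℕ} {x y : Config n} (h : hamiltonian p x < hamiltonian p y) {a b : EReal}
    (ha : IsMLE p x a) (hb : IsMLE p y b) : a < b := by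
  have ha' := ha.ne_top h
  have hb' := hb.ne_bot h
  induction a with
  | top => exact absurd rfl ha'
  | bot => exact bot_lt_iff_ne_bot.2 hb'
  | coe r =>
    induction b with
    | bot => exact absurd rfl hb'
    | top => exact EReal.coe_lt_top r
    | coe r' =>
      have hx := IsExtendedArgmax.le_of_coe (differentiable_pmf p x).continuous ha
      have hy := IsExtendedArgmax.le_of_coe (differentiable_pmf p y).continuous hb
      rw [EReal.coe_lt_coe_iff]
      by_contra! hle
      have hd : 0 < hamiltonian p y - hamiltonian p x := by linarith
      rcases hle.lt_or_eq with hlt | rfl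
      · have h1 : pmf p r' y < pmf p r y := by
          rw [pmf_eq_pmf_mul p r' x y, pmf_eq_pmf_mul p r x y]
          calc _ ≤ pmf p r x * Real.exp (r' * (hamiltonian p y - hamiltonian p x)) := by
                gcongr; exact hx r'
            _ < _ := by
                have := pmf_pos p r x
                gcongr
        exact absurd (hy r) (not_le.2 h1)
      · -- at a common maximizer both derivatives vanish, which forces equal statistics
        have hx' : HasDerivAt (fun β => pmf p β x) 0 r' := by
          have h1 := (differentiable_pmf p x r').hasDerivAt
          rwa [(show IsLocalMax (fun β => pmf p β x) r' from
            Eventually.of_forall hx).hasDerivAt_eq_zero h1] at h1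
        have hexp : HasDerivAt (fun β : ℝ => Real.exp (β * (hamiltonian p y - hamiltonian p x)))
            (Real.exp (r' * (hamiltonian p y - hamiltonian p x)) *
              (1 * (hamiltonian p y - hamiltonian p x))) r' :=
          ((hasDerivAt_id r').mul_const _).exp
        have h2 := hx'.mul hexp
        have h3 : IsLocalMax (fun β => pmf p β y) r' := Eventually.of_forall hy
        have h4 := h3.hasDerivAt_eq_zero (h2.congr_of_eventuallyEq
          (Eventually.of_forall fun β => pmf_eq_pmf_mul p β x y))
        have := pmf_pos p r' x
        have h5 : 0 < pmf p r' x * (Real.exp (r' * (hamiltonian p y - hamiltonian p x)) *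
              (1 * (hamiltonian p y - hamiltonian p x))) := by positivity
        linarith

lemma fold_le_fold {p : ℕ} (hp : p ≠ 0) {x y : ℝ} (h : x ^ p ≤ y ^ p) : fold p x ≤ fold p y := by
  unfold fold
  split_ifs with he
  · rw [← he.pow_abs x, ← he.pow_abs y] at h
    exact (pow_le_pow_iff_left₀ (abs_nonneg x) (abs_nonneg y) hp).1 h
  · exact (Nat.not_even_iff_odd.1 he).strictMono_pow.le_iff_le.1 h

lemma hasTailRate_mle {p : ℕ} (hp : 2 ≤ p) {β₀ β : ℝ} (hβ₀ : betaStar p < β₀) (hβ : β₀ < β)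
    {b : Estimator} (hb : ∀ n, 1 ≤ n → ∀ x : Config n, IsMLE p x (b n x)) :
    HasTailRate p β₀ β b (H p β₀ (mStar p β)) := by
  intro ε hε
  have hm₀ := mStar_lt_mStar hp hβ₀ hβ
  have hm := (mStar_spec hp (hβ₀.trans hβ)).1
  have hm₀0 := (mStar_spec hp hβ₀).1.1
  have hcont := (continuous_H p β₀).continuousAt (x := mStar p β)
  have hanti := (H_strictAntiOn_mStar hp hβ₀).antitoneOn
  obtain ⟨m₁, hm₁, hm₁0, hm₁m⟩ := (((hcont.mono_left (nhdsWithin_le_nhds (s := Iio _))).eventually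
    (gt_mem_nhds (show H p β₀ (mStar p β) < H p β₀ (mStar p β) + ε by linarith))).and
    (Ioo_mem_nhdsLT hm₀)).exists
  obtain ⟨y, hy, hym, hy1⟩ := (((hcont.mono_left (nhdsWithin_le_nhds (s := Ioi _))).eventually
    (lt_mem_nhds (show H p β₀ (mStar p β) - ε < H p β₀ (mStar p β) by linarith))).and
    (Ioo_mem_nhdsGT hm.2)).exists
  obtain ⟨m₂, hmm₂, hm₂y⟩ := exists_between hym
  obtain ⟨ρ, hρ, hnear⟩ := exists_near_mStar hp (hβ₀.trans hβ) (Ioo_mem_nhds hm₁m hmm₂)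
  refine ⟨ρ, hρ, y, ⟨by linarith [hm.1], hy1.le⟩, Ioi m₂, Ioi_mem_nhds hm₂y, hy, ?_⟩
  filter_upwards [eventually_ge_atTop 1] with n hn x hx
  have hn' : (0 : ℝ) < n := by exact_mod_cast hn
  obtain ⟨hx1, hx2⟩ := hnear _ (avg_mem_Icc x) hx
  constructor
  · intro x' hx'
    have hle : avg x ^ p ≤ avg x' ^ p := by
      by_contra! hlt
      refine absurd (IsMLE.lt ?_ (hb n hn x') (hb n hn x)) (not_lt.2 hx'.le)
      rw [hamiltonian_eq (by omega), hamiltonian_eq (by omega)]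
      gcongr
    have h1 := fold_le_fold (by omega) hle
    have h2 := (fold_mem_Icc (p := p) (avg_mem_Icc x')).2
    rw [← H_fold]
    exact (hanti ⟨hm₁0.le, by linarith⟩ ⟨by linarith, h2⟩ (by linarith)).trans hm₁.le
  · intro x' hx'
    refine IsMLE.lt ?_ (hb n hn x) (hb n hn x')
    rw [hamiltonian_eq (by omega), hamiltonian_eq (by omega), ← fold_pow p (avg x)]
    have : fold p (avg x) < avg x' := hx2.trans hx'
    have : 0 ≤ fold p (avg x) := by linarith
    gcongr

/-- `H p β₀` decreases beyond `mStar p β`, so its supremum there is the boundary value. -/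
lemma supHRight_eq {p : ℕ} (hp : 2 ≤ p) {β₀ β : ℝ} (hβ₀ : betaStar p < β₀) (hβ : β₀ < β) :
    supHRight p β₀ β = H p β₀ (mStar p β) := by
  have hm₀ := mStar_lt_mStar hp hβ₀ hβ
  have hm := (mStar_spec hp (hβ₀.trans hβ)).1
  have hanti := (H_strictAntiOn_mStar hp hβ₀).antitoneOn
  refine csSup_eq_of_forall_le_of_forall_lt_exists_gt
    (Nonempty.image _ ⟨1, ⟨by norm_num, le_rfl⟩, hm.2⟩) ?_ fun w hw => ?_
  · rintro _ ⟨x, ⟨hx, hmx⟩, rfl⟩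
    exact hanti ⟨hm₀.le, hm.2.le⟩ ⟨hm₀.le.trans hmx.le, hx.2⟩ hmx.le
  · have hcont := (continuous_H p β₀).continuousAt (x := mStar p β)
    obtain ⟨y, hy, hym, hy1⟩ := (((hcont.mono_left (nhdsWithin_le_nhds (s := Ioi _))).eventually
      (lt_mem_nhds hw)).and (Ioo_mem_nhdsGT hm.2)).exists
    exact ⟨_, ⟨y, ⟨⟨by linarith [hm.1], hy1.le⟩, hym⟩, rfl⟩, hy⟩

lemma H_mStar_lt_supH {p : ℕ} (hp : 2 ≤ p) {β₀ β : ℝ} (hβ₀ : betaStar p < β₀) (hβ : β₀ < β) :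
    H p β₀ (mStar p β) < supH p β₀ := by
  have hm₀ := mStar_lt_mStar hp hβ₀ hβ
  obtain ⟨h1, -, -, h2, -⟩ := mStar_spec hp hβ₀
  have hm := (mStar_spec hp (hβ₀.trans hβ)).1
  rw [← h2]
  exact H_strictAntiOn_mStar hp hβ₀ ⟨le_rfl, h1.2.le⟩ ⟨hm₀.le, hm.2.le⟩ hm₀

/-! ### The score of the pseudolikelihood -/

/-- The divided difference `(y ^ p - (y - 2h) ^ p) / (2h)`, in a form continuous at `h = 0`. -/
def diffQuot (p : ℕ) (y h : ℝ) : ℝ := ∑ i ∈ Finset.range p, y ^ i * (y - 2 * h) ^ (p - 1 - i)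

lemma diffQuot_mul (p : ℕ) (y h : ℝ) : diffQuot p y h * (2 * h) = y ^ p - (y - 2 * h) ^ p := by
  rw [diffQuot, ← geom_sum₂_mul]
  ring

lemma diffQuot_zero (p : ℕ) (y : ℝ) : diffQuot p y 0 = p * y ^ (p - 1) := by
  rw [diffQuot, Finset.sum_congr rfl (g := fun _ => y ^ (p - 1))]
  · simp
  · intro i hi
    rw [mul_zero, sub_zero, ← pow_add]
    congr 1
    have := Finset.mem_range.1 hi
    omega

/-- The increment of the sufficient statistic produced by the spin of site `i`, as compared with the
opposite spin. -/
def spinGain (p : ℕ) {n : ℕ} (x : Config n) (i : Fin n) : ℝ :=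
  2 * spin x i * diffQuot p (avg x) (spin x i * (1 / n))

lemma avg_flip {n : ℕ} (x : Config n) (i : Fin n) :
    avg (Function.update x i (-x i)) = avg x - 2 * (spin x i * (1 / n)) := by
  have h : spin (Function.update x i (-x i)) = Function.update (spin x) i (-spin x i) := by
    funext j
    by_cases hj : j = i
    · subst hj; simp [spin]
    · simp [spin, hj]
  rw [avg, avg, h, Finset.sum_update_of_mem (Finset.mem_univ i),
    Finset.sum_eq_add_sum_sdiff_singleton_of_mem (Finset.mem_univ i) (spin x)]
  ring

lemma hamiltonian_flip {p n : ℕ} (hp : 1 ≤ p) (x : Config n) (i : Fin n) :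
    hamiltonian p (Function.update x i (-x i)) = hamiltonian p x - spinGain p x i := by
  have hn : (n : ℝ) ≠ 0 := by
    have := i.pos
    positivity
  have hgain : spinGain p x i = n * (avg x ^ p - (avg x - 2 * (spin x i * (1 / n))) ^ p) := by
    rw [← diffQuot_mul, spinGain]
    field_simp
  rw [hamiltonian_eq hp, hamiltonian_eq hp, avg_flip, hgain]
  ring

lemma condProb_eq {p n : ℕ} (hp : 1 ≤ p) (β : ℝ) (x : Config n) (i : Fin n) :
    condProb p β x i = (1 + Real.exp (-(β * spinGain p x i)))⁻¹ := by
  have hsum : ∑ s : ℤˣ, pmf p β (Function.update x i s) =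
      pmf p β x + pmf p β (Function.update x i (-x i)) := by
    have h1 : pmf p β x = pmf p β (Function.update x i (x i)) := by rw [Function.update_eq_self]
    rw [h1]
    rcases Int.units_eq_one_or (x i) with h | h <;> rw [h] <;> simp [add_comm]
  have hpos := pmf_pos p β x
  rw [condProb, hsum, pmf_eq_pmf_mul p β x (Function.update x i (-x i)), hamiltonian_flip hp,
    show β * (hamiltonian p x - spinGain p x i - hamiltonian p x) = -(β * spinGain p x i) by ring]
  have := Real.exp_pos (-(β * spinGain p x i))
  field_simp

/-- The derivative in `t` of the log-pseudolikelihood. -/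
def score (p : ℕ) {n : ℕ} (x : Config n) (t : ℝ) : ℝ :=
  ∑ i, spinGain p x i / (1 + Real.exp (t * spinGain p x i))

lemma hasDerivAt_log_pseudolikelihood {p n : ℕ} (hp : 1 ≤ p) (x : Config n) (t : ℝ) :
    HasDerivAt (fun β => Real.log (pseudolikelihood p β x)) (score p x t) t := by
  have h : (fun β => Real.log (pseudolikelihood p β x)) =
      fun β => ∑ i, -Real.log (1 + Real.exp (-(β * spinGain p x i))) := by
    funext β
    rw [pseudolikelihood, Real.log_prod fun i _ => ?_]
    · exact Finset.sum_congr rfl fun i _ => by rw [condProb_eq hp, Real.log_inv]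
    · rw [condProb_eq hp]
      positivity
  rw [h, score]
  refine HasDerivAt.fun_sum fun i _ => ?_
  set d := spinGain p x i
  have h1 : HasDerivAt (fun β : ℝ => 1 + Real.exp (-(β * d)))
      (Real.exp (-(t * d)) * -(1 * d)) t :=
    (((hasDerivAt_id t).mul_const d).neg.exp).const_add 1
  have h2 := (h1.log (by positivity)).neg
  refine h2.congr_deriv ?_
  rw [Real.exp_neg]
  have := Real.exp_pos (t * d)
  field_simp
  ring

lemma pseudolikelihood_pos {p n : ℕ} (hp : 1 ≤ p) (β : ℝ) (x : Config n) :
    0 < pseudolikelihood p β x :=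
  Finset.prod_pos fun i _ => by rw [condProb_eq hp]; positivity

lemma score_antitone (p : ℕ) {n : ℕ} (x : Config n) : Antitone (score p x) := by
  intro s t hst
  refine Finset.sum_le_sum fun i _ => ?_
  set d := spinGain p x i
  have h1 := Real.exp_pos (s * d)
  have h2 := Real.exp_pos (t * d)
  rw [div_le_div_iff₀ (by positivity) (by positivity)]
  rcases le_total 0 d with hd | hd
  · have : Real.exp (s * d) ≤ Real.exp (t * d) := Real.exp_le_exp.2 (by nlinarith)
    nlinarith
  · have : Real.exp (t * d) ≤ Real.exp (s * d) := Real.exp_le_exp.2 (by nlinarith)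
    nlinarith

lemma IsMPLE.le_of_score_neg {p n : ℕ} (hp : 1 ≤ p) {x : Config n} {b : EReal} (hb : IsMPLE p x b)
    {t : ℝ} (ht : score p x t < 0) : b ≤ t := by
  have hd := hasDerivAt_log_pseudolikelihood hp x
  obtain ⟨a, ha⟩ : ∃ a, pseudolikelihood p t x < pseudolikelihood p a x := by
    by_contra! hmax
    have h1 : IsLocalMax (fun β => Real.log (pseudolikelihood p β x)) t :=
      Eventually.of_forall fun a => Real.log_le_log (pseudolikelihood_pos hp a x) (hmax a)
    exact ht.ne (h1.hasDerivAt_eq_zero (hd t))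
  refine IsExtendedArgmax.le_of_antitoneOn hb (fun r hr s hs hrs => ?_) ha
  have hanti : AntitoneOn (fun β => Real.log (pseudolikelihood p β x)) (Ici t) := by
    refine antitoneOn_of_deriv_nonpos (convex_Ici t)
      (fun s _ => (hd s).continuousAt.continuousWithinAt)
      (fun s _ => (hd s).differentiableAt.differentiableWithinAt) fun s hs => ?_
    rw [interior_Ici] at hs
    rw [(hd s).deriv]
    exact (score_antitone p x (le_of_lt hs)).trans ht.le
  exact (Real.log_le_log_iff (pseudolikelihood_pos hp s x) (pseudolikelihood_pos hp r x)).1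
    (hanti hr hs hrs)

lemma IsMPLE.ge_of_score_pos {p n : ℕ} (hp : 1 ≤ p) {x : Config n} {b : EReal} (hb : IsMPLE p x b)
    {t : ℝ} (ht : 0 < score p x t) : (t : EReal) ≤ b := by
  have hd := hasDerivAt_log_pseudolikelihood hp x
  obtain ⟨a, ha⟩ : ∃ a, pseudolikelihood p t x < pseudolikelihood p a x := by
    by_contra! hmax
    have h1 : IsLocalMax (fun β => Real.log (pseudolikelihood p β x)) t :=
      Eventually.of_forall fun a => Real.log_le_log (pseudolikelihood_pos hp a x) (hmax a)
    exact ht.ne' (h1.hasDerivAt_eq_zero (hd t))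
  refine IsExtendedArgmax.ge_of_monotoneOn hb (fun r hr s hs hrs => ?_) ha
  have hmono : MonotoneOn (fun β => Real.log (pseudolikelihood p β x)) (Iic t) := by
    refine monotoneOn_of_deriv_nonneg (convex_Iic t)
      (fun s _ => (hd s).continuousAt.continuousWithinAt)
      (fun s _ => (hd s).differentiableAt.differentiableWithinAt) fun s hs => ?_
    rw [interior_Iic] at hs
    rw [(hd s).deriv]
    exact ht.le.trans (score_antitone p x (le_of_lt hs))
  exact (Real.log_le_log_iff (pseudolikelihood_pos hp r x) (pseudolikelihood_pos hp s x)).1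
    (hmono hr hs hrs)

/-- The score per site, as a function of the inverse `h` of the number of sites and of the
magnetization `y`. -/
def scoreDensity (p : ℕ) (t h y : ℝ) : ℝ :=
  (1 + y) * (diffQuot p y h / (1 + Real.exp (2 * (t * diffQuot p y h)))) -
    (1 - y) * (diffQuot p y (-h) / (1 + Real.exp (-(2 * (t * diffQuot p y (-h))))))

lemma score_eq (p : ℕ) {n : ℕ} (hn : 1 ≤ n) (x : Config n) (t : ℝ) :
    score p x t = n * scoreDensity p t (1 / n) (avg x) := by
  have hn' : (n : ℝ) ≠ 0 := by positivity
  set φ : ℝ → ℝ := fun s => 2 * s * diffQuot p (avg x) (s * (1 / n)) /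
    (1 + Real.exp (t * (2 * s * diffQuot p (avg x) (s * (1 / n))))) with hφ
  have h1 : ∀ i, spinGain p x i / (1 + Real.exp (t * spinGain p x i)) =
      (φ 1 + φ (-1)) / 2 + (φ 1 - φ (-1)) / 2 * spin x i := by
    intro i
    have : spinGain p x i / (1 + Real.exp (t * spinGain p x i)) = φ (spin x i) := rfl
    rw [this]
    rcases spin_eq_one_or x i with h | h <;> rw [h] <;> ring
  have h2 : ∑ i, spin x i = n * avg x := by rw [avg]; field_simp
  have h3 : φ 1 = 2 * (diffQuot p (avg x) (1 / n) /
      (1 + Real.exp (2 * (t * diffQuot p (avg x) (1 / n))))) := by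
    rw [hφ]; ring_nf
  have h4 : φ (-1) = -(2 * (diffQuot p (avg x) (-(1 / n)) /
      (1 + Real.exp (-(2 * (t * diffQuot p (avg x) (-(1 / n)))))))) := by
    rw [hφ]; ring_nf
  rw [score, Finset.sum_congr rfl fun i _ => h1 i, Finset.sum_add_distrib, ← Finset.mul_sum, h2,
    h3, h4, scoreDensity]
  simp only [Finset.sum_const, Finset.card_univ, Fintype.card_fin, nsmul_eq_mul]
  ring

/-- A function with the sign of the limiting score at `t`; for positive `y` it is positive iff
`η(y) > t`. -/
def drift (p : ℕ) (t y : ℝ) : ℝ :=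
  y ^ (p - 1) * ((1 + y) - (1 - y) * Real.exp (2 * (t * (p * y ^ (p - 1)))))

lemma scoreDensity_zero (p : ℕ) (t y : ℝ) :
    scoreDensity p t 0 y = p / (1 + Real.exp (2 * (t * (p * y ^ (p - 1))))) * drift p t y := by
  rw [scoreDensity, neg_zero, diffQuot_zero, drift, Real.exp_neg]
  have := Real.exp_pos (2 * (t * (p * y ^ (p - 1))))
  field_simp
  ring

lemma continuous_scoreDensity (p : ℕ) (t : ℝ) :
    Continuous fun z : ℝ × ℝ => scoreDensity p t z.1 z.2 := by
  have h : ∀ a : ℝ, 1 + Real.exp a ≠ 0 := fun a => by positivity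
  have h1 : Continuous fun z : ℝ × ℝ => diffQuot p z.2 z.1 := by unfold diffQuot; fun_prop
  have h2 : Continuous fun z : ℝ × ℝ => diffQuot p z.2 (-z.1) := by unfold diffQuot; fun_prop
  exact ((continuous_const.add continuous_snd).mul (h1.div (by fun_prop) fun _ => h _)).sub
    ((continuous_const.sub continuous_snd).mul (h2.div (by fun_prop) fun _ => h _))

/-! ### Estimators that track `η` of the magnetization -/

/-- The estimator `b` compares with positive thresholds `t` as `η` of the magnetization does:
asymptotically, uniformly for magnetizations in compact sets where `η ≠ t`. For `p ≥ 3` the drift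
vanishes at `0`, which is harmless because `0` is adherent to `{η > t}`; for `p = 2` a neighbourhood
of `0` needs a separate condition. -/
structure TracksEta (p : ℕ) (b : Estimator) : Prop where
  ge : ∀ t : ℝ, 0 < t → ∀ K : Set ℝ, IsCompact K → K ⊆ Icc (-1) 1 → (∀ y ∈ K, 0 < drift p t y) →
    ∀ᶠ n : ℕ in atTop, ∀ x : Config n, avg x ∈ K → (t : EReal) ≤ b n x
  le : ∀ t : ℝ, 0 < t → ∀ K : Set ℝ, IsCompact K → K ⊆ Icc (-1) 1 → (∀ y ∈ K, drift p t y < 0) →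
    ∀ᶠ n : ℕ in atTop, ∀ x : Config n, avg x ∈ K → b n x ≤ t
  near_zero : p = 2 → ∀ t : ℝ, 1 / 2 < t → ∃ z > 0, ∀ᶠ n : ℕ in atTop, ∀ x : Config n,
    |avg x| ≤ z → b n x ≤ t

/-- A lower bound `c a ≤ tanh a` near zero, for `c < 1`, cleared of denominators. -/
lemma two_le_mul_one_add_exp {c a : ℝ} (hc0 : 0 < c) (hc : c < 1) (ha0 : 0 ≤ a) (ha : a ≤ 1 - c) :
    2 ≤ (1 - c * a) * (1 + Real.exp (2 * a)) := by
  have h1 := Real.quadratic_le_exp_of_nonneg (show 0 ≤ 2 * a by positivity)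
  have h2 : 0 ≤ 1 - c * a := by nlinarith
  have h3 : c * a ^ 2 ≤ 1 - c := by nlinarith
  calc (2 : ℝ) ≤ (1 - c * a) * (1 + (1 + 2 * a + (2 * a) ^ 2 / 2)) := by nlinarith
    _ ≤ _ := by gcongr

lemma scoreDensity_two_neg {t : ℝ} (ht : 1 / 2 < t) :
    ∃ z > 0, ∀ h, 0 < h → h ≤ z → ∀ y, |y| ≤ z → scoreDensity 2 t h y < 0 := by
  -- any `c` strictly between `1 / (2t)` and `1` works
  set c := (1 + 2 * t) / (4 * t) with hc
  have ht0 : 0 < t := by linarith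
  have hc0 : 0 < c := by positivity
  have hc1 : c < 1 := by rw [hc, div_lt_one (by positivity)]; linarith
  set κ := 2 * t * c with hκ
  have hκ1 : 1 < κ := by
    have : κ = (1 + 2 * t) / 2 := by rw [hκ, hc]; field_simp; ring
    rw [this]; linarith
  refine ⟨min ((1 - c) / (4 * t)) (1 / (2 * κ)), lt_min (div_pos (by linarith) (by positivity))
    (by positivity), ?_⟩
  intro h hh0 hhz
  have hQ : ∀ y k : ℝ, diffQuot 2 y k = 2 * (y - k) := fun y k => by
    simp [diffQuot, Finset.sum_range_succ]; ring
  -- the score density is even in `y`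
  have main : ∀ y, 0 ≤ y → y ≤ min ((1 - c) / (4 * t)) (1 / (2 * κ)) →
      scoreDensity 2 t h y < 0 := by
    intro y hy0 hyz
    obtain ⟨hy1, hy2⟩ := le_min_iff.1 hyz
    obtain ⟨hh1, -⟩ := le_min_iff.1 hhz
    rw [le_div_iff₀ (by positivity)] at hy1 hy2 hh1
    have hylt : y < 1 / 2 := by nlinarith
    set b := 2 * t * (y + h) with hb
    have hB := two_le_mul_one_add_exp hc0 hc1 (a := b) (by positivity) (by rw [hb]; linarith)
    have hBexp := Real.exp_pos (2 * b)
    have hB' : (1 + κ * (y + h)) / 2 ≤ 1 / (1 + Real.exp (-(2 * b))) := by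
      have e : κ * (y + h) = c * b := by rw [hκ, hb]; ring
      rw [e, Real.exp_neg, div_le_div_iff₀ (by positivity) (by positivity)]
      generalize Real.exp (2 * b) = E at hB hBexp
      field_simp
      linarith
    have hden : scoreDensity 2 t h y = 2 * ((1 + y) * (y - h) *
        (1 / (1 + Real.exp (2 * (2 * t * (y - h)))))) -
        2 * ((1 - y) * (y + h) * (1 / (1 + Real.exp (-(2 * b))))) := by
      rw [scoreDensity, hQ, hQ, hb]; ring_nf
    have hBB : (1 - y) * (y + h) * ((1 + κ * (y + h)) / 2) ≤
        (1 - y) * (y + h) * (1 / (1 + Real.exp (-(2 * b)))) :=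
      mul_le_mul_of_nonneg_left hB' (mul_nonneg (by linarith) (by linarith))
    rw [hden]
    rcases lt_or_ge y h with hyh | hyh
    · have h1 : (1 + y) * (y - h) * (1 / (1 + Real.exp (2 * (2 * t * (y - h))))) < 0 :=
        mul_neg_of_neg_of_pos (mul_neg_of_pos_of_neg (by linarith) (by linarith)) (by positivity)
      have h2 : 0 ≤ (1 - y) * (y + h) * (1 / (1 + Real.exp (-(2 * b)))) :=
        mul_nonneg (mul_nonneg (by linarith) (by linarith)) (by positivity)
      linarith
    · set a := 2 * t * (y - h) with ha
      have ha0 : 0 ≤ a := mul_nonneg (by positivity) (by linarith)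
      have hA := two_le_mul_one_add_exp hc0 hc1 (a := a) ha0 (by rw [ha]; nlinarith)
      have hA' : 1 / (1 + Real.exp (2 * a)) ≤ (1 - κ * (y - h)) / 2 := by
        have e : κ * (y - h) = c * a := by rw [hκ, ha]; ring
        rw [e, div_le_div_iff₀ (by positivity) (by positivity)]
        linarith
      have hAA : (1 + y) * (y - h) * (1 / (1 + Real.exp (2 * a))) ≤
          (1 + y) * (y - h) * ((1 - κ * (y - h)) / 2) :=
        mul_le_mul_of_nonneg_left hA' (mul_nonneg (by linarith) (by linarith))
      have hpoly : 2 * ((1 - y) * (y + h) * ((1 + κ * (y + h)) / 2)) -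
          2 * ((1 + y) * (y - h) * ((1 - κ * (y - h)) / 2)) =
          2 * h * (1 - (2 * κ * y) * y) + 2 * (κ - 1) * y ^ 2 + 2 * κ * h ^ 2 := by ring
      have h1 : (2 * κ * y) * y ≤ 1 := by nlinarith
      have h2 : 0 ≤ 2 * h * (1 - (2 * κ * y) * y) := mul_nonneg (by linarith) (by linarith)
      have h3 : 0 ≤ 2 * (κ - 1) * y ^ 2 := mul_nonneg (by linarith) (by positivity)
      have h4 : 0 < 2 * κ * h ^ 2 := by positivity
      linarith
  intro y hy
  rcases le_total 0 y with h0 | h0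
  · exact main y h0 ((le_abs_self y).trans hy)
  · have heven : scoreDensity 2 t h y = scoreDensity 2 t h (-y) := by
      simp only [scoreDensity, hQ]
      ring_nf
    rw [heven]
    exact main (-y) (by linarith) ((neg_le_abs y).trans hy)

lemma tracksEta_of_isMPLE {p : ℕ} (hp : 2 ≤ p) {b : Estimator}
    (hb : ∀ n, 1 ≤ n → ∀ x : Config n, IsMPLE p x (b n x)) : TracksEta p b := by
  have hp0 : (0 : ℝ) < p := by positivity
  have hp1 : 1 ≤ p := by omega
  have hlim : Tendsto (fun n : ℕ => 1 / (n : ℝ)) atTop (𝓝 0) := tendsto_one_div_atTop_nhds_zero_nat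
  have hfac : ∀ t y : ℝ, 0 < p / (1 + Real.exp (2 * (t * (p * y ^ (p - 1))))) := fun t y => by
    positivity
  refine ⟨fun t _ K hK _ hd => ?_, fun t _ K hK _ hd => ?_, ?_⟩
  · have h := hK.eventually_forall_of_forall_eventually (x₀ := (0 : ℝ))
      (P := fun h y => 0 < scoreDensity p t h y) fun y hy =>
        (continuous_scoreDensity p t).continuousAt.eventually (lt_mem_nhds (by
          simp only [scoreDensity_zero]
          exact mul_pos (hfac t y) (hd y hy)))
    filter_upwards [hlim.eventually h, eventually_ge_atTop 1] with n hn hn1 x hx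
    refine (hb n hn1 x).ge_of_score_pos hp1 ?_
    rw [score_eq p hn1]
    exact mul_pos (by exact_mod_cast hn1) (hn _ hx)
  · have h := hK.eventually_forall_of_forall_eventually (x₀ := (0 : ℝ))
      (P := fun h y => scoreDensity p t h y < 0) fun y hy =>
        (continuous_scoreDensity p t).continuousAt.eventually (gt_mem_nhds (by
          simp only [scoreDensity_zero]
          exact mul_neg_of_pos_of_neg (hfac t y) (hd y hy)))
    filter_upwards [hlim.eventually h, eventually_ge_atTop 1] with n hn hn1 x hx
    refine (hb n hn1 x).le_of_score_neg hp1 ?_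
    rw [score_eq p hn1]
    exact mul_neg_of_pos_of_neg (by exact_mod_cast hn1) (hn _ hx)
  · rintro rfl t ht
    obtain ⟨z, hz, h⟩ := scoreDensity_two_neg ht
    refine ⟨z, hz, ?_⟩
    filter_upwards [hlim.eventually (gt_mem_nhds hz), eventually_ge_atTop 1] with n hn hn1 x hx
    have hn' : (0 : ℝ) < n := by exact_mod_cast hn1
    refine (hb n hn1 x).le_of_score_neg hp1 ?_
    rw [score_eq 2 hn1]
    exact mul_neg_of_pos_of_neg hn' (h _ (by positivity) hn.le _ hx)

/-! ### The explicit maximum pseudolikelihood estimator -/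

lemma lt_etaReal_iff {p : ℕ} (hp : 2 ≤ p) {y : ℝ} (hy : y ∈ Ioo (0 : ℝ) 1) (t : ℝ) :
    t < etaReal p y ↔ (1 - y) * Real.exp (2 * (t * (p * y ^ (p - 1)))) < 1 + y := by
  have h1 : 0 < 1 - y := by linarith [hy.2]
  have h2 : 0 < 1 + y := by linarith [hy.1]
  have h3 := hy.1
  rw [etaReal, lt_div_iff₀ (by positivity), Real.artanh_eq_half_log ⟨by linarith, by linarith⟩,
    mul_comm (1 - y), ← lt_div_iff₀ h1, ← Real.lt_log_iff_exp_lt (by positivity)]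
  constructor <;> intro h <;> linarith

lemma drift_pos_iff {p : ℕ} {t y : ℝ} (hy : 0 < y) :
    0 < drift p t y ↔ (1 - y) * Real.exp (2 * (t * (p * y ^ (p - 1)))) < 1 + y := by
  rw [drift, mul_pos_iff_of_pos_left (pow_pos hy _), sub_pos]

lemma drift_neg_iff {p : ℕ} {t y : ℝ} (hy : 0 < y) :
    drift p t y < 0 ↔ 1 + y < (1 - y) * Real.exp (2 * (t * (p * y ^ (p - 1)))) := by
  rw [drift, ← neg_pos, ← mul_neg, mul_pos_iff_of_pos_left (pow_pos hy _), neg_pos, sub_neg]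

lemma exists_drift_fold_eq {p : ℕ} (hp : 2 ≤ p) (t x : ℝ) :
    ∃ c > 0, drift p t (fold p x) = c * drift p t x := by
  unfold fold
  split_ifs with he
  · rcases abs_choice x with h | h <;> rw [h]
    · exact ⟨1, one_pos, by ring⟩
    · have hodd : Odd (p - 1) := Nat.Even.sub_odd (by omega) he odd_one
      refine ⟨Real.exp (2 * (t * (p * -x ^ (p - 1)))), Real.exp_pos _, ?_⟩
      have e : Real.exp (2 * (t * (p * x ^ (p - 1)))) *
          Real.exp (2 * (t * (p * -x ^ (p - 1)))) = 1 := by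
        rw [← Real.exp_add, ← Real.exp_zero]; ring_nf
      rw [drift, drift, hodd.neg_pow]
      linear_combination (x ^ (p - 1) * (1 - x)) * e
  · exact ⟨1, one_pos, by ring⟩

lemma drift_fold_pos_iff {p : ℕ} (hp : 2 ≤ p) {t x : ℝ} :
    0 < drift p t (fold p x) ↔ 0 < drift p t x := by
  obtain ⟨c, hc, h⟩ := exists_drift_fold_eq hp t x
  rw [h, mul_pos_iff_of_pos_left hc]

lemma drift_fold_neg_iff {p : ℕ} (hp : 2 ≤ p) {t x : ℝ} :
    drift p t (fold p x) < 0 ↔ drift p t x < 0 := by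
  obtain ⟨c, hc, h⟩ := exists_drift_fold_eq hp t x
  rw [h, ← neg_pos, ← mul_neg, mul_pos_iff_of_pos_left hc, neg_pos]

lemma not_even_of_fold_neg {p : ℕ} {x : ℝ} (h : fold p x < 0) : ¬Even p := fun he => by
  rw [fold, if_pos he] at h
  exact absurd h (not_lt.2 (abs_nonneg x))

lemma drift_neg_of_neg {p : ℕ} (hp : ¬Even p) {t y : ℝ} (ht : 0 < t) (hy : y < 0) :
    drift p t y < 0 := by
  have hpow : 0 < y ^ (p - 1) := (Nat.Odd.sub_odd (Nat.not_even_iff_odd.1 hp) odd_one).pow_pos hy.ne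
  have h1 : 1 ≤ Real.exp (2 * (t * (p * y ^ (p - 1)))) := Real.one_le_exp (by positivity)
  rw [drift]
  refine mul_neg_of_pos_of_neg hpow ?_
  nlinarith

lemma drift_zero {p : ℕ} (hp : 2 ≤ p) (t : ℝ) : drift p t 0 = 0 := by
  rw [drift, zero_pow (by omega), zero_mul]

lemma eta_one {p : ℕ} (hp : 2 ≤ p) : eta p 1 = ⊤ := by
  have : (0 : ℝ) < (p : ℝ)⁻¹ := by positivity
  simp [eta, artanhExt, EReal.coe_mul_top_of_pos this]

lemma eta_eq_etaReal {p : ℕ} (hp : 2 ≤ p) {y : ℝ} (hy : y ∈ Ioo (0 : ℝ) 1) :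
    eta p y = etaReal p y := by
  have h1 : y ≠ -1 := by linarith [hy.1]
  rw [eta, artanhExt, if_neg hy.1.ne', if_neg hy.2.ne, if_neg h1, ← EReal.coe_mul, etaReal]
  have e : 1 - (p : ℤ) = -((p - 1 : ℕ) : ℤ) := by omega
  rw [e, zpow_neg, zpow_natCast]
  congr 1
  field_simp

lemma eta_fold {p : ℕ} {x : ℝ} (hx : x ∈ Icc (-1 : ℝ) 1) :
    eta p (fold p x) = eta p x := by
  unfold fold
  split_ifs with he
  · rcases le_or_gt 0 x with h0 | h0
    · rw [abs_of_nonneg h0]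
    · rw [abs_of_neg h0]
      have hodd : Odd (1 - (p : ℤ)) := by
        rw [Int.odd_sub]; simp [he]
      have hart : artanhExt (-x) = -artanhExt x := by
        rcases hx.1.eq_or_lt with rfl | hlt
        · norm_num [artanhExt]
        · have h1 : x ≠ 1 := by linarith
          have h2 : x ≠ -1 := hlt.ne'
          have h3 : -x ≠ 1 := by linarith
          have h4 : -x ≠ -1 := by simpa using h1
          rw [artanhExt, artanhExt, if_neg h1, if_neg h2, if_neg h3, if_neg h4, ← EReal.coe_neg,
            artanh_eq_log_sub_log ⟨by linarith, by linarith⟩,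
            artanh_eq_log_sub_log ⟨by linarith, by linarith⟩]
          congr 1
          ring_nf
      rw [eta, eta, if_neg h0.ne, if_neg (neg_ne_zero.2 h0.ne), hart, hodd.neg_zpow,
        mul_neg (p : ℝ)⁻¹, EReal.coe_neg, neg_mul_neg]
  · rfl

lemma eta_nonpos {p : ℕ} (hp : 2 ≤ p) (he : ¬Even p) {y : ℝ} (hy1 : -1 ≤ y) (hy : y ≤ 0) :
    eta p y ≤ 0 := by
  rcases hy.eq_or_lt with rfl | hlt
  · simp [eta]
  have heven : Even (1 - (p : ℤ)) := by
    rw [Int.even_sub]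
    simp [he]
  have hpos : 0 < (p : ℝ)⁻¹ * y ^ (1 - (p : ℤ)) :=
    mul_pos (by positivity) (heven.zpow_pos hlt.ne)
  rw [eta, if_neg hlt.ne, artanhExt, if_neg (by linarith)]
  split_ifs
  · rw [EReal.coe_mul_bot_of_pos hpos]
    exact bot_le
  · rw [← EReal.coe_mul]
    exact_mod_cast mul_nonpos_of_nonneg_of_nonpos hpos.le (Real.artanh_nonpos hy)

lemma coe_lt_eta_iff {p : ℕ} (hp : 2 ≤ p) {y : ℝ} (hy : y ∈ Ioc (0 : ℝ) 1) (t : ℝ) :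
    (t : EReal) < eta p y ↔ 0 < drift p t y := by
  rw [drift_pos_iff hy.1]
  rcases hy.2.eq_or_lt with rfl | hlt
  · simp [eta_one hp, EReal.coe_lt_top]
  · rw [eta_eq_etaReal hp ⟨hy.1, hlt⟩, EReal.coe_lt_coe_iff, lt_etaReal_iff hp ⟨hy.1, hlt⟩]

lemma fold_pos_of_drift_pos {p : ℕ} (hp : 2 ≤ p) {t x : ℝ} (ht : 0 < t)
    (h : 0 < drift p t x) : 0 < fold p x := by
  by_contra! hle
  rw [← drift_fold_pos_iff hp] at h
  rcases hle.eq_or_lt with h0 | hlt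
  · rw [h0, drift_zero hp] at h
    exact lt_irrefl _ h
  · exact absurd (drift_neg_of_neg (not_even_of_fold_neg hlt) ht hlt) (not_lt.2 h.le)

lemma fold_pos_of_lt_eta {p : ℕ} (hp : 2 ≤ p) {t x : ℝ} (hx : x ∈ Icc (-1 : ℝ) 1) (ht : 0 < t)
    (h : (t : EReal) < eta p x) : 0 < fold p x := by
  by_contra! hle
  rw [← eta_fold hx] at h
  have h0 : eta p (fold p x) ≤ 0 := by
    rcases hle.eq_or_lt with h0 | hlt
    · simp [h0, eta]
    · exact eta_nonpos hp (not_even_of_fold_neg hlt) (fold_mem_Icc hx).1 hle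
  exact absurd (h.trans_le h0) (not_lt.2 (by exact_mod_cast ht.le))

/-- The region `η > t` in terms of the drift. -/
lemma coe_lt_eta_iff_drift_pos {p : ℕ} (hp : 2 ≤ p) {t x : ℝ} (hx : x ∈ Icc (-1 : ℝ) 1)
    (ht : 0 < t) : (t : EReal) < eta p x ↔ 0 < drift p t x := by
  constructor <;> intro h
  · have hpos := fold_pos_of_lt_eta hp hx ht h
    rw [← eta_fold hx, coe_lt_eta_iff hp ⟨hpos, (fold_mem_Icc hx).2⟩] at h
    exact (drift_fold_pos_iff hp).1 h
  · have hpos := fold_pos_of_drift_pos hp ht h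
    rw [← eta_fold hx, coe_lt_eta_iff hp ⟨hpos, (fold_mem_Icc hx).2⟩]
    exact (drift_fold_pos_iff hp).2 h

lemma tracksEta_mple {p : ℕ} (hp : 2 ≤ p) : TracksEta p (mple p) := by
  refine ⟨fun t ht K _ hK hd => ?_, fun t ht K _ hK hd => ?_, ?_⟩
  · refine Eventually.of_forall fun n x hx => ?_
    exact ((coe_lt_eta_iff_drift_pos hp (hK hx) ht).2 (hd _ hx)).le
  · refine Eventually.of_forall fun n x hx => ?_
    refine not_lt.1 fun h => ?_
    exact absurd ((coe_lt_eta_iff_drift_pos hp (hK hx) ht).1 h) (not_lt.2 (hd _ hx).le)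
  · rintro rfl t ht
    obtain ⟨z, hz, h⟩ := scoreDensity_two_neg ht
    refine ⟨z, hz, Eventually.of_forall fun n x hx => ?_⟩
    refine not_lt.1 fun hlt => ?_
    have hd := (coe_lt_eta_iff_drift_pos hp (avg_mem_Icc x) (by linarith)).1 hlt
    -- the limiting score is a limit of negative finite-size scores
    have hlim : Tendsto (fun h => scoreDensity 2 t h (avg x)) (𝓝[>] 0)
        (𝓝 (scoreDensity 2 t 0 (avg x))) :=
      (((continuous_scoreDensity 2 t).comp (Continuous.prodMk_left (avg x))).tendsto 0).mono_left
        nhdsWithin_le_nhds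
    have hle : scoreDensity 2 t 0 (avg x) ≤ 0 := by
      refine le_of_tendsto hlim ?_
      filter_upwards [Ioc_mem_nhdsGT hz] with k hk
      exact (h k hk.1 hk.2 _ hx).le
    rw [scoreDensity_zero] at hle
    exact absurd hle (not_le.2 (mul_pos (by positivity) hd))

/-! ### The tail rate of the pseudolikelihood tests -/

/-- The value of the supremum of `H p β₀` over the set where `η > β`: this set contains a right
neighbourhood of `mStar p β` and, for `p ≥ 3`, a right neighbourhood of `0`, where `H` vanishes. -/
def etaTail (p : ℕ) (β₀ β : ℝ) : ℝ :=
  if p = 2 then H p β₀ (mStar p β) else max 0 (H p β₀ (mStar p β))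

lemma H_mStar_le_etaTail (p : ℕ) (β₀ β : ℝ) : H p β₀ (mStar p β) ≤ etaTail p β₀ β := by
  rw [etaTail]
  split_ifs
  exacts [le_rfl, le_max_right _ _]

lemma etaTail_nonneg {p : ℕ} (hp : p ≠ 2) (β₀ β : ℝ) : 0 ≤ etaTail p β₀ β := by
  rw [etaTail, if_neg hp]
  exact le_max_left _ _

lemma self_lt_artanh {x : ℝ} (hx : x ∈ Ioo (0 : ℝ) 1) : x < Real.artanh x := by
  have h : StrictMonoOn (fun x => Real.artanh x - x) (Ico 0 1) := by
    have hd : ∀ x ∈ Ico (0 : ℝ) 1,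
        HasDerivAt (fun x => Real.artanh x - x) (1 / (1 - x ^ 2) - 1) x :=
      fun x hx => (hasDerivAt_artanh ⟨by linarith [hx.1], hx.2⟩).sub (hasDerivAt_id x)
    refine strictMonoOn_of_deriv_pos (convex_Ico _ _)
      (fun x hx => (hd x hx).continuousAt.continuousWithinAt) fun x hx => ?_
    rw [interior_Ico] at hx
    rw [(hd x ⟨hx.1.le, hx.2⟩).deriv, sub_pos, lt_div_iff₀ (by nlinarith [hx.1, hx.2])]
    nlinarith [hx.1]
  have h1 := h ⟨le_rfl, one_pos⟩ ⟨hx.1.le, hx.2⟩ hx.1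
  simp only [Real.artanh_zero, sub_self] at h1
  linarith

lemma half_lt_etaReal_two {x : ℝ} (hx : x ∈ Ioo (0 : ℝ) 1) : 1 / 2 < etaReal 2 x := by
  have h := self_lt_artanh hx
  have h0 := hx.1
  rw [etaReal, lt_div_iff₀ (by positivity)]
  norm_num
  linarith

/-- Targets for the lower bound: points where `H p β₀` is nearly `etaTail p β₀ β`, with compact
neighbourhoods in which `η` stays above some value larger than `β`. -/
lemma exists_target {p : ℕ} (hp : 2 ≤ p) {β₀ β : ℝ} (hβ₀ : betaStar p < β₀) (hβ : β₀ < β)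
    {ε : ℝ} (hε : 0 < ε) :
    ∃ m' ∈ Ioo (mStar p β) 1, ∃ y ∈ Icc (-1 : ℝ) 1, ∃ K ∈ 𝓝 y, IsCompact K ∧ K ⊆ Icc (-1) 1 ∧
      etaTail p β₀ β - ε < H p β₀ y ∧ ∀ z ∈ K, 0 < drift p (etaReal p m') z := by
  obtain ⟨hm, hc, hη, -⟩ := mStar_spec hp (hβ₀.trans hβ)
  have hβpos : 0 < β := (betaStar_nonneg p).trans_lt (hβ₀.trans hβ)
  by_cases hS : etaTail p β₀ β = H p β₀ (mStar p β)
  · have hcont := (continuous_H p β₀).continuousAt (x := mStar p β)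
    obtain ⟨y, hy, hym, hy1⟩ := (((hcont.mono_left (nhdsWithin_le_nhds (s := Ioi _))).eventually
      (lt_mem_nhds (show H p β₀ (mStar p β) - ε < H p β₀ (mStar p β) by linarith))).and
      (Ioo_mem_nhdsGT hm.2)).exists
    obtain ⟨y₁, hmy₁, hy₁y⟩ := exists_between hym
    obtain ⟨m', hmm', hm'y⟩ := exists_between hmy₁
    have hm'0 : 0 < m' := hm.1.trans hmm'
    have hm'1 : m' < 1 := by linarith
    refine ⟨m', ⟨hmm', hm'1⟩, y, ⟨by linarith, hy1.le⟩, Icc y₁ 1, Icc_mem_nhds hy₁y hy1,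
      isCompact_Icc, fun z hz => ⟨by linarith [hz.1], hz.2⟩, by rwa [hS], fun z hz => ?_⟩
    have hz0 : 0 < z := by linarith [hz.1]
    rcases hz.2.eq_or_lt with rfl | hz1
    · rw [drift_pos_iff one_pos]
      norm_num
    · rw [drift_pos_iff hz0, ← lt_etaReal_iff hp ⟨hz0, hz1⟩]
      exact etaReal_strictMonoOn hp ⟨⟨hm'0, hm'1⟩, (hc.trans hmm').le⟩
        ⟨⟨hz0, hz1⟩, show turn p ≤ z by linarith [hz.1]⟩ (by linarith [hz.1])
  · have hp2 : p ≠ 2 := fun h => hS (by rw [etaTail, if_pos h])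
    have hS0 : etaTail p β₀ β = 0 := by
      rw [etaTail, if_neg hp2] at hS ⊢
      exact (max_choice _ _).resolve_right hS
    obtain ⟨m', hm'⟩ := exists_between hm.2
    have hm'0 : 0 < m' := hm.1.trans hm'.1
    set t := etaReal p m'
    have hβt : β < t := by
      rw [← hη]
      exact etaReal_strictMonoOn hp ⟨hm, hc.le⟩ ⟨⟨hm'0, hm'.2⟩, (hc.trans hm'.1).le⟩ hm'.1
    have htpos : 0 < t := hβpos.trans hβt
    set s := min 1 (1 / (p * t))
    have hs : 0 < s := lt_min one_pos (by positivity)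
    have hcont := (continuous_H p β₀).continuousAt (x := 0)
    obtain ⟨y, hy, hy0, hys⟩ := (((hcont.mono_left (nhdsWithin_le_nhds (s := Ioi _))).eventually
      (lt_mem_nhds (show -ε < H p β₀ 0 by rw [H_zero hp]; linarith))).and
      (Ioo_mem_nhdsGT hs)).exists
    have hs1 : s ≤ 1 := min_le_left _ _
    have hst : s ≤ 1 / (p * t) := min_le_right _ _
    refine ⟨m', hm', y, ⟨by linarith, by linarith⟩, Icc (y / 2) ((y + s) / 2),
      Icc_mem_nhds (by linarith) (by linarith), isCompact_Icc,
      fun z hz => ⟨by linarith [hz.1], by linarith [hz.2]⟩, by rw [hS0]; linarith, fun z hz => ?_⟩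
    have hz0 : 0 < z := by linarith [hz.1]
    have hzs : z < s := by linarith [hz.2]
    have hz1 : z < 1 := by linarith
    rw [drift_pos_iff hz0, ← lt_etaReal_iff hp ⟨hz0, hz1⟩]
    change t < Real.artanh z / (p * z ^ (p - 1))
    rw [lt_div_iff₀ (by positivity)]
    refine lt_of_lt_of_le ?_ (self_lt_artanh ⟨hz0, hz1⟩).le
    have hpow : z ^ (p - 1) ≤ z ^ 2 := pow_le_pow_of_le_one hz0.le hz1.le (by omega)
    have hzt := hzs.trans_le hst
    rw [lt_div_iff₀ (by positivity)] at hzt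
    calc t * (p * z ^ (p - 1)) ≤ t * (p * z ^ 2) := by gcongr
      _ = (z * (p * t)) * z := by ring
      _ < 1 * z := by gcongr
      _ = z := one_mul z

lemma supHEta_eq {p : ℕ} (hp : 2 ≤ p) {β₀ β : ℝ} (hβ₀ : betaStar p < β₀) (hβ : β₀ < β) :
    supHEta p β₀ β = etaTail p β₀ β := by
  obtain ⟨hm, hc, hη, -⟩ := mStar_spec hp (hβ₀.trans hβ)
  have hβpos : 0 < β := (betaStar_nonneg p).trans_lt (hβ₀.trans hβ)
  have hm₀ := mStar_lt_mStar hp hβ₀ hβ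
  have hex : ∀ ε, 0 < ε → ∃ y, (y ∈ Icc (-1 : ℝ) 1 ∧ (β : EReal) < eta p y) ∧
      etaTail p β₀ β - ε < H p β₀ y := by
    intro ε hε
    obtain ⟨m', hm', y, hy, K, hK, -, -, hyS, hd⟩ := exists_target hp hβ₀ hβ hε
    have hβt : β < etaReal p m' := by
      rw [← hη]
      exact etaReal_strictMonoOn hp ⟨hm, hc.le⟩
        ⟨⟨hm.1.trans hm'.1, hm'.2⟩, (hc.trans hm'.1).le⟩ hm'.1
    refine ⟨y, ⟨hy, (EReal.coe_lt_coe_iff.2 hβt).trans ?_⟩, hyS⟩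
    exact (coe_lt_eta_iff_drift_pos hp hy (hβpos.trans hβt)).2 (hd y (mem_of_mem_nhds hK))
  refine csSup_eq_of_forall_le_of_forall_lt_exists_gt
    (Nonempty.image _ ((hex 1 one_pos).imp fun _ h => h.1)) ?_ fun w hw => ?_
  · rintro _ ⟨x, ⟨hx, hxβ⟩, rfl⟩
    have hpos := fold_pos_of_lt_eta hp hx hβpos hxβ
    have hle := (fold_mem_Icc (p := p) hx).2
    rw [← eta_fold hx, coe_lt_eta_iff hp ⟨hpos, hle⟩, drift_pos_iff hpos, ← hη] at hxβ
    rw [← H_fold]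
    rcases le_or_H_nonpos hp hβ₀ hm₀.le hm.2 ⟨hpos, hle⟩ hxβ.le with h | ⟨hp2, h⟩
    · exact ((H_strictAntiOn_mStar hp hβ₀).antitoneOn ⟨hm₀.le, hm.2.le⟩
        ⟨hm₀.le.trans h, hle⟩ h).trans (H_mStar_le_etaTail p β₀ β)
    · exact h.trans (etaTail_nonneg hp2 β₀ β)
  · obtain ⟨y, hy, hyS⟩ := hex (etaTail p β₀ β - w) (by linarith)
    exact ⟨_, ⟨y, hy, rfl⟩, by linarith⟩

lemma etaTail_lt_supH {p : ℕ} (hp : 2 ≤ p) {β₀ β : ℝ} (hβ₀ : betaStar p < β₀) (hβ : β₀ < β) :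
    etaTail p β₀ β < supH p β₀ := by
  rw [etaTail]
  split_ifs
  · exact H_mStar_lt_supH hp hβ₀ hβ
  · exact max_lt (supH_pos hp hβ₀) (H_mStar_lt_supH hp hβ₀ hβ)

lemma TracksEta.hasTailRate {p : ℕ} (hp : 2 ≤ p) {β₀ β : ℝ} (hβ₀ : betaStar p < β₀) (hβ : β₀ < β)
    {b : Estimator} (hb : TracksEta p b) : HasTailRate p β₀ β b (etaTail p β₀ β) := by
  intro ε hε
  obtain ⟨hm, hc, hη, -⟩ := mStar_spec hp (hβ₀.trans hβ)
  obtain ⟨hm₀I, hc₀, hη₀, -⟩ := mStar_spec hp hβ₀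
  have hβ₀pos : 0 < β₀ := (betaStar_nonneg p).trans_lt hβ₀
  have hm₀ := mStar_lt_mStar hp hβ₀ hβ
  have hanti := (H_strictAntiOn_mStar hp hβ₀).antitoneOn
  have hmono : ∀ a c, mStar p β₀ ≤ a → a < c → c < 1 → etaReal p a < etaReal p c :=
    fun a c ha hac hc1 => etaReal_strictMonoOn hp
      ⟨⟨hm₀I.1.trans_le ha, hac.trans hc1⟩, hc₀.le.trans ha⟩
      ⟨⟨hm₀I.1.trans_le (ha.trans hac.le), hc1⟩, hc₀.le.trans (ha.trans hac.le)⟩ hac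
  obtain ⟨m₃, ⟨hmm₃, hm₃1⟩, y, hy, U, hU, hUc, hUI, hyS, hUd⟩ := exists_target hp hβ₀ hβ hε
  -- thresholds `m₁ < m₁' < mStar p β < m₂ < m₂' < m₃`
  have hcont := (continuous_H p β₀).continuousAt (x := mStar p β)
  obtain ⟨m₁, hm₁, hm₁0, hm₁m⟩ := (((hcont.mono_left (nhdsWithin_le_nhds (s := Iio _))).eventually
    (gt_mem_nhds (show H p β₀ (mStar p β) < etaTail p β₀ β + ε by
      linarith [H_mStar_le_etaTail p β₀ β]))).and (Ioo_mem_nhdsLT hm₀)).exists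
  obtain ⟨m₁', hm₁m₁', hm₁'m⟩ := exists_between hm₁m
  obtain ⟨m₂', hmm₂', hm₂'m₃⟩ := exists_between hmm₃
  obtain ⟨m₂, hmm₂, hm₂m₂'⟩ := exists_between hmm₂'
  have ht₁ : β₀ < etaReal p m₁ := by
    rw [← hη₀]
    exact hmono _ _ le_rfl hm₁0 (by linarith)
  have ht₂₃ : etaReal p m₂' < etaReal p m₃ := hmono _ _ (by linarith) hm₂'m₃ hm₃1
  have ht₂ : β₀ < etaReal p m₂' := by
    rw [← hη₀]
    exact hmono _ _ le_rfl (by linarith) (by linarith)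
  obtain ⟨ρ, hρ, hnear⟩ := exists_near_mStar hp (hβ₀.trans hβ) (Icc_mem_nhds hm₁'m hmm₂)
  -- typical samples have estimates between `η(m₁)` and `η(m₂')`
  set K₁ := Icc (-1 : ℝ) 1 ∩ fold p ⁻¹' Icc m₁' m₂
  have hK₁ : IsCompact K₁ := isCompact_Icc.inter_right (isClosed_Icc.preimage (continuous_fold p))
  have hge := hb.ge (etaReal p m₁) (by linarith) K₁ hK₁ inter_subset_left fun z hz => by
    obtain ⟨hz1, hz2⟩ := hz.2
    have hz0 : 0 < fold p z := by linarith [hm₀I.1]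
    rw [← drift_fold_pos_iff hp, drift_pos_iff hz0, ← lt_etaReal_iff hp ⟨hz0, by linarith⟩]
    exact hmono _ _ hm₁0.le (by linarith) (by linarith)
  have hle := hb.le (etaReal p m₂') (by linarith) K₁ hK₁ inter_subset_left fun z hz => by
    obtain ⟨hz1, hz2⟩ := hz.2
    have hz0 : 0 < fold p z := by linarith [hm₀I.1]
    rw [← drift_fold_neg_iff hp, drift_neg_iff hz0, ← not_le,
      ← le_etaReal_iff hp ⟨hz0, by linarith⟩, not_le]
    exact hmono _ _ (by linarith) (by linarith) (by linarith)
  -- estimates above `η(m₁)` force `H p β₀` to be at most `etaTail p β₀ β + ε`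
  obtain ⟨z₀, hz₀, hzero⟩ : ∃ z₀ : ℝ, (p = 2 → 0 < z₀) ∧ ∀ᶠ n : ℕ in atTop, ∀ x : Config n,
      |avg x| < z₀ → b n x ≤ etaReal p m₁ := by
    by_cases hp2 : p = 2
    · obtain ⟨z, hz, hev⟩ := hb.near_zero hp2 (etaReal p m₁) (by
        rw [hp2]
        exact half_lt_etaReal_two ⟨by linarith [hm₀I.1], by linarith⟩)
      exact ⟨z, fun _ => hz, hev.mono fun n hn x hx => hn x hx.le⟩
    · exact ⟨0, fun h => absurd h hp2,
        Eventually.of_forall fun n x hx => absurd hx (not_lt.2 (abs_nonneg _))⟩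
  set K₂ := Icc (-1 : ℝ) 1 ∩ {z | etaTail p β₀ β + ε ≤ H p β₀ z ∧ z₀ ≤ |z|}
  have hK₂ : IsCompact K₂ := isCompact_Icc.inter_right
    ((isClosed_le continuous_const (continuous_H p β₀)).inter
      (isClosed_le continuous_const continuous_abs))
  have hle₂ := hb.le (etaReal p m₁) (by linarith) K₂ hK₂ inter_subset_left fun z hz => by
    obtain ⟨hzI, hzH, hz₀z⟩ := hz
    rw [← drift_fold_neg_iff hp]
    rw [← H_fold] at hzH
    have hfI := fold_mem_Icc (p := p) hzI
    by_contra! hd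
    have hf0 : fold p z ≠ 0 := by
      intro h0
      rw [h0, H_zero hp] at hzH
      by_cases hp2 : p = 2
      · rw [fold, if_pos (by rw [hp2]; exact even_two)] at h0
        linarith [hz₀ hp2]
      · linarith [etaTail_nonneg hp2 β₀ β]
    rcases hf0.lt_or_gt with hneg | hpos
    · exact absurd (drift_neg_of_neg (not_even_of_fold_neg hneg) (hβ₀pos.trans ht₁) hneg)
        (not_lt.2 hd)
    · rw [← not_lt, drift_neg_iff hpos, not_lt] at hd
      rcases le_or_H_nonpos hp hβ₀ hm₁0.le (by linarith) ⟨hpos, hfI.2⟩ hd with h | ⟨hp2, h⟩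
      · linarith [hanti ⟨hm₁0.le, by linarith⟩ ⟨hm₁0.le.trans h, hfI.2⟩ h]
      · linarith [etaTail_nonneg hp2 β₀ β]
  have hge₃ := hb.ge (etaReal p m₃) (by linarith) U hUc hUI hUd
  refine ⟨ρ, hρ, y, hy, U, hU, hyS, ?_⟩
  filter_upwards [hge, hle, hzero, hle₂, hge₃] with n hn₁ hn₂ hn₀ hn₃ hn₄ x hx
  have hxK : avg x ∈ K₁ := ⟨avg_mem_Icc x, hnear _ (avg_mem_Icc x) hx⟩
  constructor
  · intro x' hx'
    have hlt : (etaReal p m₁ : EReal) < b n x' := (hn₁ x hxK).trans_lt hx'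
    by_contra! hH
    have h0 : z₀ ≤ |avg x'| := not_lt.1 fun h => absurd (hn₀ x' h) (not_le.2 hlt)
    exact absurd (hn₃ x' ⟨avg_mem_Icc x', hH.le, h0⟩) (not_le.2 hlt)
  · intro x' hx'
    exact (hn₂ x hxK).trans_lt ((EReal.coe_lt_coe_iff.2 ht₂₃).trans_le (hn₄ x' hx'))

end CurieWeiss

end

theorem theorem1 (p : ℕ) (hp : 2 ≤ p) (β₀ β : ℝ) (hβ₀ : betaStar p < β₀) (hβ : β₀ < β)
    (bML bMPL : Estimator)
    (hML : ∀ n, 1 ≤ n → ∀ x : Config n, IsMLE p x (bML n x))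
    (hMPL : ∀ n, 1 ≤ n → ∀ x : Config n, IsMPLE p x (bMPL n x)) :
    (HasWeakBahadurSlope p β₀ β (mple p) (2 * (supH p β₀ - supHEta p β₀ β)) ∧
      HasWeakBahadurSlope p β₀ β bMPL (2 * (supH p β₀ - supHEta p β₀ β)) ∧
      HasWeakBahadurSlope p β₀ β bML (2 * (supH p β₀ - supHRight p β₀ β))) ∧
    (HasMinSampleSize.{u} p β₀ β (mple p)
        (fun δ => Real.log δ / (supHEta p β₀ β - supH p β₀)) ∧
      HasMinSampleSize.{u} p β₀ β bMPL
        (fun δ => Real.log δ / (supHEta p β₀ β - supH p β₀)) ∧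
      HasMinSampleSize.{u} p β₀ β bML
        (fun δ => Real.log δ / (supHRight p β₀ β - supH p β₀))) := by
  have hp1 : 1 ≤ p := by omega
  have h1 := (tracksEta_mple hp).hasTailRate hp hβ₀ hβ
  have h2 := (tracksEta_of_isMPLE hp hMPL).hasTailRate hp hβ₀ hβ
  have h3 := hasTailRate_mle hp hβ₀ hβ hML
  have hS := etaTail_lt_supH hp hβ₀ hβ
  rw [supHEta_eq hp hβ₀ hβ, supHRight_eq hp hβ₀ hβ]
  exact ⟨⟨h1.hasWeakBahadurSlope hp1, h2.hasWeakBahadurSlope hp1, h3.hasWeakBahadurSlope hp1⟩,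
    h1.hasMinSampleSize hp1 hS, h2.hasMinSampleSize hp1 hS,
    h3.hasMinSampleSize hp1 (H_mStar_lt_supH hp hβ₀ hβ)⟩
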